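/- **Notation.** Let $\Sigma$ be a convex polygon. A triangulation of $\Sigma$ is a maximal set of pairwise non-crossing diagonals. A flip replaces a diagonal of a triangulation, which is a diagonal of a convex quadrilateral formed by two adjacent triangles, by the other diagonal of that quadrilateral. For triangulations $\mathcal T^+,\mathcal T^-$ of $\Sigma$ let $\mathrm{flip}(\mathcal T^+,\mathcal T^-)$ be the least number of flips that transform $\mathcal T^+$ into $\mathcal T^-$. Let $\tau$ be the triangulated sphere obtained by placing $\mathcal T^+$ on top of $\mathcal T^-$ and gluing them along the boundary of $\Sigma$; its triangles are those of $\mathcal T^+$ and those of $\mathcal T^-$. A tetrahedral decomposition extending $\tau$ is a gluing of finitely many tetrahedra by affine identifications of some of their faces in pairs, such that the resulting space is homeomorphic to the closed $3$-ball and its boundary, formed by the faces that are not glued, is (simplicially isomorphic to) $\tau$. Let $\mathrm{tet}(\tau)$ be the least number of tetrahedra in a tetrahedral decomposition extending $\tau$. **Theorem.** 1. For every $\varepsilon>0$ there are a convex polygon and triangulations $\mathcal T^+,\mathcal T^-$ of it such that $$\left|\frac{\mathrm{flip}(\mathcal T^+,\mathcal T^-)}{\mathrm{tet}(\tau)}-\frac32\right|<\varepsilon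 .$$ 2. Let $n\ge 2$, and let $\Sigma_n$ be a convex polygon with $2n+4$ vertices, labelled in cyclic order $B,v_1,\dots,v_n,A,C,u_n,\dots,u_1,D$. Let $\mathcal T^+_n$ be the triangulation of $\Sigma_n$ with the diagonals $BC$, $Bu_i$ and $Cv_i$ $(1\le i\le n)$, let $\mathcal T^-_n$ be the one with the diagonals $AD$, $Au_i$ and $Dv_i$ $(1\le i\le n)$, and let $\tau_n$ be the triangulated sphere obtained from $\mathcal T^+_n$ and $\mathcal T^-_n$. Then $$\mathrm{flip}(\mathcal T^+_n,\mathcal T^-_n)=3n+1\qquad\text{and}\qquad \mathrm{tet}(\tau_n)=2n+3 .$$ -/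

import Mathlib

/-! ## Triangulations of a convex polygon and flips

The vertices of a convex `N`-gon are numbered `0, 1, ..., N - 1` in their cyclic order along the
boundary. -/

/-- The edge `e` is a side of the convex `N`-gon: it joins two cyclically consecutive vertices. -/
def IsSide {N : ℕ} (e : Sym2 (Fin N)) : Prop :=
  ∃ i j : Fin N, e = s(i, j) ∧ (j.val = i.val + 1 ∨ (i.val = 0 ∧ j.val + 1 = N))

/-- The edge `e` is a diagonal of the convex `N`-gon: it joins two distinct vertices and is not
a side. -/
def IsDiagonal {N : ℕ} (e : Sym2 (Fin N)) : Prop :=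
  ¬ e.IsDiag ∧ ¬ IsSide e

/-- The edges `d` and `e` cross in the interior of the convex `N`-gon: their endpoints are four
different vertices which alternate along the boundary. -/
def Crosses {N : ℕ} (d e : Sym2 (Fin N)) : Prop :=
  ∃ p q r s : Fin N, p < q ∧ q < r ∧ r < s ∧
    ((d = s(p, r) ∧ e = s(q, s)) ∨ (d = s(q, s) ∧ e = s(p, r)))

/-- A triangulation of the convex `N`-gon, given by its diagonals: a maximal set of pairwise
non-crossing diagonals. -/
@[ext]
structure PolygonTriangulation (N : ℕ) where
  three_le : 3 ≤ N
  diagonals : Finset (Sym2 (Fin N))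
  isDiagonal : ∀ e ∈ diagonals, IsDiagonal e
  nonCrossing : ∀ d ∈ diagonals, ∀ e ∈ diagonals, ¬ Crosses d e
  maximal : ∀ e, IsDiagonal e → (∀ d ∈ diagonals, ¬ Crosses d e) → e ∈ diagonals

namespace PolygonTriangulation

variable {N : ℕ}

/-- The edges of a triangulation are its diagonals and the sides of the polygon. -/
def IsEdge (T : PolygonTriangulation N) (e : Sym2 (Fin N)) : Prop :=
  e ∈ T.diagonals ∨ IsSide e

/-- `T.IsTriangle t` says that `t` is the vertex set of a triangle of the triangulation `T`: three
vertices that are pairwise joined by edges of `T`. (As the polygon has no vertex in its interior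
and edges do not cross, such a triple always bounds a face.) -/
def IsTriangle (T : PolygonTriangulation N) (t : Finset (Fin N)) : Prop :=
  t.card = 3 ∧ ∀ i ∈ t, ∀ j ∈ t, i ≠ j → T.IsEdge s(i, j)

/-- `T'` is obtained from `T` by a flip: there is a quadrilateral `pqrs` all of whose sides are
edges of `T`, one of whose diagonals belongs to `T`, and `T'` arises from `T` by replacing this
diagonal by the other diagonal of `pqrs`. -/
def IsFlip (T T' : PolygonTriangulation N) : Prop :=
  ∃ p q r s : Fin N, p < q ∧ q < r ∧ r < s ∧
    T.IsEdge s(p, q) ∧ T.IsEdge s(q, r) ∧ T.IsEdge s(r, s) ∧ T.IsEdge s(p, s) ∧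
    ((s(p, r) ∈ T.diagonals ∧ T'.diagonals = insert s(q, s) (T.diagonals.erase s(p, r))) ∨
     (s(q, s) ∈ T.diagonals ∧ T'.diagonals = insert s(p, r) (T.diagonals.erase s(q, s))))

end PolygonTriangulation

/-- The flip graph of the convex `N`-gon: its vertices are the triangulations, and two of them are
adjacent if one is obtained from the other by a flip. -/
def flipGraph (N : ℕ) : SimpleGraph (PolygonTriangulation N) :=
  SimpleGraph.fromRel PolygonTriangulation.IsFlip

/-- The flip distance: the length of a shortest path in the flip graph. (Mathlib's distance would be
`0` if there were no path; a positive value always is the length of a shortest path.) -/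
noncomputable def flipDist {N : ℕ} (T T' : PolygonTriangulation N) : ℕ :=
  (flipGraph N).dist T T'

/-! ## The sphere obtained from two triangulations -/

/-- The polygon, triangulated by `T`, realised as the union of the triangles of `T`. A point is
given by its barycentric coordinates, a weight for each vertex of the polygon. -/
def PolygonTriangulation.disc {N : ℕ} (T : PolygonTriangulation N) : Set (Fin N → ℝ) :=
  {w | w ∈ stdSimplex ℝ (Fin N) ∧ ∃ t, T.IsTriangle t ∧ ∀ k, k ∉ t → w k = 0}

/-- The point with barycentric coordinates `w` lies on a side of the polygon. -/
def OnRim {N : ℕ} (w : Fin N → ℝ) : Prop :=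
  ∃ i j : Fin N, IsSide s(i, j) ∧ ∀ k, k ≠ i → k ≠ j → w k = 0

/-- A point of the top disc and a point of the bottom disc are glued if they are the same point of
the boundary of the polygon. -/
def rimRel {N : ℕ} (T T' : PolygonTriangulation N) :
    (T.disc ⊕ T'.disc) → (T.disc ⊕ T'.disc) → Prop
  | Sum.inl w, Sum.inr w' => w.1 = w'.1 ∧ OnRim w.1
  | _, _ => False

/-- The triangulated sphere `τ` obtained by placing `T` on top of `T'` and gluing them along the
boundary of the polygon; its triangles are those of `T` and those of `T'`. -/
def GluedSphere {N : ℕ} (T T' : PolygonTriangulation N) : Type :=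
  Quot (rimRel T T')

/-! ## Tetrahedral decompositions of the ball -/

/-- A gluing of `m` tetrahedra along faces. Each tetrahedron has vertices `0, 1, 2, 3`, and its
face `f` is the one opposite to the vertex `f`. If `glue i f = some (j, p)`, then the face `f` of the
tetrahedron `i` is glued to the face `p f` of the tetrahedron `j` by the affine map that sends the
vertex `k` to the vertex `p k`, for `k ≠ f`; if `glue i f = none`, then this face is not glued to
anything, so that it is a boundary face. -/
structure TetGluing (m : ℕ) where
  glue : Fin m → Fin 4 → Option (Fin m × Equiv.Perm (Fin 4))
  glue_symm : ∀ i f j p, glue i f = some (j, p) → glue j (p f) = some (i, p⁻¹)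
  glue_ne : ∀ i f j p, glue i f = some (j, p) → (j, p f) ≠ (i, f)

namespace TetGluing

variable {m : ℕ}

/-- The point `x` of the face `f` of some tetrahedron is glued directly to the point `y`. -/
def Rel (G : TetGluing m) (x y : Fin m × stdSimplex ℝ (Fin 4)) : Prop :=
  ∃ f p, G.glue x.1 f = some (y.1, p) ∧ x.2.1 f = 0 ∧ ∀ k, y.2.1 (p k) = x.2.1 k

/-- The topological space obtained from `m` disjoint tetrahedra by the gluing (the quotient by
the equivalence relation that `G.Rel` generates). -/
def Space (G : TetGluing m) : Type :=
  Quot G.Rel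

instance (G : TetGluing m) : TopologicalSpace G.Space :=
  inferInstanceAs (TopologicalSpace (Quot G.Rel))

/-- The glued space is homeomorphic to the closed ball of dimension three. -/
def IsBall (G : TetGluing m) : Prop :=
  Nonempty (G.Space ≃ₜ Metric.closedBall (0 : EuclideanSpace ℝ (Fin 3)) 1)

/-- `ψ` maps the triangle `t` of `T` affinely onto the face `f` of the tetrahedron `i`, by a
bijection of the vertices. -/
def IsFaceMap {N : ℕ} (G : TetGluing m) {T : PolygonTriangulation N} (ψ : T.disc → G.Space)
    (t : Finset (Fin N)) (i : Fin m) (f : Fin 4) : Prop :=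
  ∃ e : Fin 4 → Fin N, Set.BijOn e {k | k ≠ f} {v | v ∈ t} ∧
    ∀ (w : T.disc) (x : stdSimplex ℝ (Fin 4)), (∀ v, v ∉ t → w.1 v = 0) →
      x.1 f = 0 → (∀ k, k ≠ f → x.1 k = w.1 (e k)) → ψ w = Quot.mk G.Rel (i, x)

/-- The boundary of the glued space is `τ`: there is an injection of the sphere `τ` into the glued
space which maps each triangle of `τ` affinely onto a boundary face, and each boundary face is
obtained in this way. (Such an injection is continuous, as it is affine on each triangle.) -/
def Extends {N : ℕ} (G : TetGluing m) (T T' : PolygonTriangulation N) : Prop :=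
  ∃ Φ : GluedSphere T T' → G.Space, Function.Injective Φ ∧
    (∀ t, T.IsTriangle t → ∃ i f, G.glue i f = none ∧
      G.IsFaceMap (fun w : T.disc => Φ (Quot.mk _ (Sum.inl w))) t i f) ∧
    (∀ t, T'.IsTriangle t → ∃ i f, G.glue i f = none ∧
      G.IsFaceMap (fun w : T'.disc => Φ (Quot.mk _ (Sum.inr w))) t i f) ∧
    (∀ i f, G.glue i f = none →
      (∃ t, T.IsTriangle t ∧
        G.IsFaceMap (fun w : T.disc => Φ (Quot.mk _ (Sum.inl w))) t i f) ∨
      (∃ t, T'.IsTriangle t ∧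
        G.IsFaceMap (fun w : T'.disc => Φ (Quot.mk _ (Sum.inr w))) t i f))

end TetGluing

/-- `tet(τ)`, for the sphere `τ` obtained from `T` and `T'`: the least number of tetrahedra in a
decomposition of the ball whose boundary is `τ`. (The infimum of the empty set is `0`, which is never
the number of tetrahedra of a decomposition; a positive value always is an attained minimum.) -/
noncomputable def tet {N : ℕ} (T T' : PolygonTriangulation N) : ℕ :=
  sInf {m | ∃ G : TetGluing m, G.IsBall ∧ G.Extends T T'}

/-! ## The explicit family

The vertices of the `(2n+4)`-gon, in cyclic order, are `B, v₁, ..., vₙ, A, C, uₙ, ..., u₁, D`. -/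

/-- The vertex `A`. -/
def vertexA (n : ℕ) : Fin (2 * n + 4) := ⟨n + 1, by omega⟩
/-- The vertex `B`. -/
def vertexB (n : ℕ) : Fin (2 * n + 4) := ⟨0, by omega⟩
/-- The vertex `C`. -/
def vertexC (n : ℕ) : Fin (2 * n + 4) := ⟨n + 2, by omega⟩
/-- The vertex `D`. -/
def vertexD (n : ℕ) : Fin (2 * n + 4) := ⟨2 * n + 3, by omega⟩
/-- `vertexU n i` is the vertex `u_{i+1}`, for `i = 0, ..., n - 1`. -/
def vertexU (n : ℕ) (i : Fin n) : Fin (2 * n + 4) := ⟨2 * n + 2 - i.val, by omega⟩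
/-- `vertexV n j` is the vertex `v_{j+1}`, for `j = 0, ..., n - 1`. -/
def vertexV (n : ℕ) (j : Fin n) : Fin (2 * n + 4) := ⟨j.val + 1, by omega⟩

/-- The diagonals `B u_i`, `BC` and `C v_j`. -/
def diagonalsPlus (n : ℕ) : Finset (Sym2 (Fin (2 * n + 4))) :=
  insert s(vertexB n, vertexC n)
    (Finset.univ.image (fun i => s(vertexB n, vertexU n i)) ∪
      Finset.univ.image (fun j => s(vertexC n, vertexV n j)))

/-- The diagonals `A u_i`, `AD` and `D v_j`. -/
def diagonalsMinus (n : ℕ) : Finset (Sym2 (Fin (2 * n + 4))) :=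
  insert s(vertexA n, vertexD n)
    (Finset.univ.image (fun i => s(vertexA n, vertexU n i)) ∪
      Finset.univ.image (fun j => s(vertexD n, vertexV n j)))

theorem mem_diagonalsPlus (n : ℕ) (a b : Fin (2 * n + 4)) (h : a < b) :
    s(a, b) ∈ diagonalsPlus n ↔
      (a.val = 0 ∧ n + 2 ≤ b.val ∧ b.val ≤ 2 * n + 2) ∨
      (1 ≤ a.val ∧ a.val ≤ n ∧ b.val = n + 2) := by
  have h' : a.val < b.val := h
  simp only [diagonalsPlus, Finset.mem_insert, Finset.mem_union, Finset.mem_image, Finset.mem_univ,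
    true_and, Sym2.eq_iff, Fin.ext_iff, vertexB, vertexC, vertexU, vertexV]
  constructor
  · rintro (h1 | ⟨⟨i, hi⟩, h1⟩ | ⟨⟨i, hi⟩, h1⟩) <;> omega
  · rintro (⟨h1, h2, h3⟩ | ⟨h1, h2, h3⟩)
    · by_cases hb : b.val = n + 2
      · left; omega
      · right; left; exact ⟨⟨2 * n + 2 - b.val, by omega⟩, by simp only; omega⟩
    · right; right; exact ⟨⟨a.val - 1, by omega⟩, by simp only; omega⟩

theorem mem_diagonalsMinus (n : ℕ) (a b : Fin (2 * n + 4)) (h : a < b) :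
    s(a, b) ∈ diagonalsMinus n ↔
      (a.val = n + 1 ∧ n + 3 ≤ b.val) ∨
      (1 ≤ a.val ∧ a.val ≤ n ∧ b.val = 2 * n + 3) := by
  have h' : a.val < b.val := h
  have hb' := b.isLt
  simp only [diagonalsMinus, Finset.mem_insert, Finset.mem_union, Finset.mem_image, Finset.mem_univ,
    true_and, Sym2.eq_iff, Fin.ext_iff, vertexA, vertexD, vertexU, vertexV]
  constructor
  · rintro (h1 | ⟨⟨i, hi⟩, h1⟩ | ⟨⟨i, hi⟩, h1⟩) <;> omega
  · rintro (⟨h1, h2⟩ | ⟨h1, h2, h3⟩)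
    · by_cases hb : b.val = 2 * n + 3
      · left; omega
      · right; left; exact ⟨⟨2 * n + 2 - b.val, by omega⟩, by simp only; omega⟩
    · right; right; exact ⟨⟨a.val - 1, by omega⟩, by simp only; omega⟩

theorem isDiagonal_iff {N : ℕ} (a b : Fin N) (h : a < b) :
    IsDiagonal s(a, b) ↔ a.val + 2 ≤ b.val ∧ ¬ (a.val = 0 ∧ b.val + 1 = N) := by
  have h' : a.val < b.val := h
  constructor
  · rintro ⟨-, h2⟩
    constructor
    · by_contra hc
      exact h2 ⟨a, b, rfl, by omega⟩
    · intro hc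
      exact h2 ⟨a, b, rfl, by omega⟩
  · rintro ⟨h1, h2⟩
    refine ⟨by simpa using h.ne, ?_⟩
    rintro ⟨i, j, hij, h3⟩
    have := j.isLt
    rw [Sym2.eq_iff, Fin.ext_iff, Fin.ext_iff, Fin.ext_iff, Fin.ext_iff] at hij
    omega

theorem exists_lt_of_not_isDiag {N : ℕ} (e : Sym2 (Fin N)) (h : ¬ e.IsDiag) :
    ∃ a b : Fin N, a < b ∧ e = s(a, b) := by
  induction e with
  | _ a b =>
    rcases lt_trichotomy a b with hab | hab | hab
    · exact ⟨a, b, hab, rfl⟩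
    · exact absurd (by simpa using hab) h
    · exact ⟨b, a, hab, Sym2.eq_swap⟩

/-- A criterion for a set of edges to be a triangulation, in coordinates. -/
def PolygonTriangulation.ofEdges {N : ℕ} (hN : 3 ≤ N) (S : Finset (Sym2 (Fin N)))
    (hdiag : ∀ e ∈ S, ¬ e.IsDiag)
    (hside : ∀ a b : Fin N, a < b → s(a, b) ∈ S →
      a.val + 2 ≤ b.val ∧ ¬ (a.val = 0 ∧ b.val + 1 = N))
    (hcross : ∀ p q r s : Fin N, p < q → q < r → r < s → ¬ (s(p, r) ∈ S ∧ s(q, s) ∈ S))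
    (hmax : ∀ a b : Fin N, a.val + 2 ≤ b.val → ¬ (a.val = 0 ∧ b.val + 1 = N) → s(a, b) ∉ S →
      ∃ p q : Fin N, p < q ∧ s(p, q) ∈ S ∧ ((a < p ∧ p < b ∧ b < q) ∨ (p < a ∧ a < q ∧ q < b))) :
    PolygonTriangulation N where
  three_le := hN
  diagonals := S
  isDiagonal := by
    intro e he
    obtain ⟨a, b, hab, rfl⟩ := exists_lt_of_not_isDiag e (hdiag e he)
    exact (isDiagonal_iff a b hab).2 (hside a b hab he)
  nonCrossing := by
    rintro d hd e he ⟨p, q, r, s, h1, h2, h3, ⟨rfl, rfl⟩ | ⟨rfl, rfl⟩⟩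
    · exact hcross p q r s h1 h2 h3 ⟨hd, he⟩
    · exact hcross p q r s h1 h2 h3 ⟨he, hd⟩
  maximal := by
    intro e he hc
    obtain ⟨a, b, hab, rfl⟩ := exists_lt_of_not_isDiag e he.1
    by_contra hn
    obtain ⟨h1, h2⟩ := (isDiagonal_iff a b hab).1 he
    obtain ⟨p, q, -, hS, ⟨h3, h4, h5⟩ | ⟨h3, h4, h5⟩⟩ := hmax a b h1 h2 hn
    · exact hc _ hS ⟨a, p, b, q, h3, h4, h5, Or.inr ⟨rfl, rfl⟩⟩
    · exact hc _ hS ⟨p, a, q, b, h3, h4, h5, Or.inl ⟨rfl, rfl⟩⟩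

/-- The triangulation `T⁺ₙ` of the `(2n+4)`-gon, with diagonals `B u_i`, `BC` and `C v_j`. -/
def triPlus (n : ℕ) : PolygonTriangulation (2 * n + 4) :=
  PolygonTriangulation.ofEdges (by omega) (diagonalsPlus n)
    (by
      intro e he
      simp only [diagonalsPlus, Finset.mem_insert, Finset.mem_union, Finset.mem_image,
        Finset.mem_univ, true_and] at he
      rcases he with rfl | ⟨⟨i, hi⟩, rfl⟩ | ⟨⟨i, hi⟩, rfl⟩ <;>
        simp only [Sym2.mk_isDiag_iff, Fin.ext_iff, vertexB, vertexC, vertexU, vertexV] <;> omega)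
    (by
      intro a b hab h
      rw [mem_diagonalsPlus n a b hab] at h
      omega)
    (by
      rintro p q r s h1 h2 h3 ⟨h4, h5⟩
      rw [mem_diagonalsPlus n _ _ (h1.trans h2)] at h4
      rw [mem_diagonalsPlus n _ _ (h2.trans h3)] at h5
      rw [Fin.lt_def] at h1 h2 h3
      omega)
    (by
      intro a b h1 h2 h3
      have hab : a < b := by rw [Fin.lt_def]; omega
      have hb := b.isLt
      rw [mem_diagonalsPlus n a b hab] at h3
      have key : ∃ p q : ℕ, p < q ∧ q ≤ 2 * n + 3 ∧
          ((p = 0 ∧ n + 2 ≤ q ∧ q ≤ 2 * n + 2) ∨ (1 ≤ p ∧ p ≤ n ∧ q = n + 2)) ∧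
          ((a.val < p ∧ p < b.val ∧ b.val < q) ∨ (p < a.val ∧ a.val < q ∧ q < b.val)) := by
        by_cases c1 : b.val ≤ n + 1
        · exact ⟨a.val + 1, n + 2, by omega⟩
        · by_cases c2 : a.val ≤ n + 1
          · exact ⟨0, n + 2, by omega⟩
          · exact ⟨0, a.val + 1, by omega⟩
      obtain ⟨p, q, h4, h5, h6, h7⟩ := key
      refine ⟨⟨p, by omega⟩, ⟨q, by omega⟩, h4, ?_, h7⟩
      rw [mem_diagonalsPlus n _ _ (by exact h4)]
      exact h6)

/-- The triangulation `T⁻ₙ` of the `(2n+4)`-gon, with diagonals `A u_i`, `AD` and `D v_j`. -/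
def triMinus (n : ℕ) : PolygonTriangulation (2 * n + 4) :=
  PolygonTriangulation.ofEdges (by omega) (diagonalsMinus n)
    (by
      intro e he
      simp only [diagonalsMinus, Finset.mem_insert, Finset.mem_union, Finset.mem_image,
        Finset.mem_univ, true_and] at he
      rcases he with rfl | ⟨⟨i, hi⟩, rfl⟩ | ⟨⟨i, hi⟩, rfl⟩ <;>
        simp only [Sym2.mk_isDiag_iff, Fin.ext_iff, vertexA, vertexD, vertexU, vertexV] <;> omega)
    (by
      intro a b hab h
      rw [mem_diagonalsMinus n a b hab] at h
      omega)
    (by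
      rintro p q r s h1 h2 h3 ⟨h4, h5⟩
      rw [mem_diagonalsMinus n _ _ (h1.trans h2)] at h4
      rw [mem_diagonalsMinus n _ _ (h2.trans h3)] at h5
      rw [Fin.lt_def] at h1 h2 h3
      omega)
    (by
      intro a b h1 h2 h3
      have hab : a < b := by rw [Fin.lt_def]; omega
      have hb := b.isLt
      rw [mem_diagonalsMinus n a b hab] at h3
      have key : ∃ p q : ℕ, p < q ∧ q ≤ 2 * n + 3 ∧
          ((p = n + 1 ∧ n + 3 ≤ q) ∨ (1 ≤ p ∧ p ≤ n ∧ q = 2 * n + 3)) ∧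
          ((a.val < p ∧ p < b.val ∧ b.val < q) ∨ (p < a.val ∧ a.val < q ∧ q < b.val)) := by
        by_cases c1 : b.val ≤ n + 1
        · exact ⟨a.val + 1, 2 * n + 3, by omega⟩
        · by_cases c2 : a.val ≤ n
          · exact ⟨n + 1, 2 * n + 3, by omega⟩
          · exact ⟨n + 1, a.val + 1, by omega⟩
      obtain ⟨p, q, h4, h5, h6, h7⟩ := key
      refine ⟨⟨p, by omega⟩, ⟨q, by omega⟩, h4, ?_, h7⟩
      rw [mem_diagonalsMinus n _ _ (by exact h4)]
      exact h6)

/-! Everything rests on the two values of part 2: the ratio $(3n+1)/(2n+3)$ tends to $3/2$.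

Flip distance. Both triangulations have at least $2n+1$ diagonals and share none, so a flip path
must remove every diagonal of $\mathcal T^+_n$ and create every diagonal of $\mathcal T^-_n$. A flip
can do both at once, but rarely. Consider the first flip that removes an original diagonal for the
first time and creates a final diagonal $f$ for good. Any later flip of this kind removes an
original diagonal that has coexisted with $f$, hence does not cross it. Each diagonal of $\mathcal
T^-_n$ is crossed by all but at most $n$ diagonals of $\mathcal T^+_n$, so at most $n+1$ flips do
double duty and the path has length at least $2(2n+1)-(n+1)=3n+1$ (`card_add_card_le_walk_length`).
The path that passes through the fan at $B$ and then the fan at $A$ attains this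
(`reachesIn_unfan`).

Tetrahedra, lower bound. The sphere has $4n+4$ triangles and its graph contains no $K_4$, so a
tetrahedron has at most two boundary faces and at least $2n+2$ tetrahedra are needed. If $2n+2$
sufficed, each would have exactly two boundary faces. The edge of one tetrahedron that lies on
neither of its boundary faces would join non-adjacent vertices $c,d$ of the sphere; in a tetrahedron
with vertices $c,d$ no boundary face contains both, so the glued faces are those that do, and all
neighbours contain $c,d$ as well. By connectedness all tetrahedra do, and every triangle of the
sphere would contain $c$ or $d$, which fails for $n\ge2$ (`TetGluing.lt_of_isBall_of_extends`).

Tetrahedra, upper bound. Join $AB$ to the $n+1$ edges of the path $C,u_n,\dots,u_1,D$, join $CD$ to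
the $n+1$ edges of the path $B,v_1,\dots,v_n,A$, and add $ABCD$. With `fanPosition` these $2n+3$
tetrahedra are placed in space so that they fill a convex body and overlap only along glued faces
(`fanMerges`, `range_labelMap_eq_fanBody`). A convex body is a ball, and the unglued faces are the
triangles of the sphere. -/

/-! ### Sides and crossings in coordinates. -/

theorem sym2_mk_eq_iff_of_lt {N : ℕ} {a b c d : Fin N} (h : a < b) (h' : c < d) :
    s(a, b) = s(c, d) ↔ a = c ∧ b = d := by
  rw [Sym2.eq_iff]
  constructor
  · rintro (h1 | ⟨rfl, rfl⟩)
    · exact h1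
    · exact absurd h h'.asymm
  · exact Or.inl

theorem isSide_iff {N : ℕ} (a b : Fin N) (h : a < b) :
    IsSide s(a, b) ↔ b.val = a.val + 1 ∨ (a.val = 0 ∧ b.val + 1 = N) := by
  have h' : a.val < b.val := h
  constructor
  · rintro ⟨i, j, hij, h3⟩
    have := j.isLt
    rw [Sym2.eq_iff, Fin.ext_iff, Fin.ext_iff, Fin.ext_iff, Fin.ext_iff] at hij
    omega
  · intro h1
    exact ⟨a, b, rfl, by omega⟩

theorem crosses_iff {N : ℕ} {a b c d : Fin N} (h : a < b) (h' : c < d) :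
    Crosses s(a, b) s(c, d) ↔ (a < c ∧ c < b ∧ b < d) ∨ (c < a ∧ a < d ∧ d < b) := by
  constructor
  · rintro ⟨p, q, r, s, h1, h2, h3, ⟨h4, h5⟩ | ⟨h4, h5⟩⟩
    · rw [sym2_mk_eq_iff_of_lt h (h1.trans h2)] at h4
      rw [sym2_mk_eq_iff_of_lt h' (h2.trans h3)] at h5
      obtain ⟨⟨rfl, rfl⟩, rfl, rfl⟩ := And.intro h4 h5
      exact Or.inl ⟨h1, h2, h3⟩
    · rw [sym2_mk_eq_iff_of_lt h (h2.trans h3)] at h4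
      rw [sym2_mk_eq_iff_of_lt h' (h1.trans h2)] at h5
      obtain ⟨⟨rfl, rfl⟩, rfl, rfl⟩ := And.intro h4 h5
      exact Or.inr ⟨h1, h2, h3⟩
  · rintro (⟨h1, h2, h3⟩ | ⟨h1, h2, h3⟩)
    · exact ⟨a, c, b, d, h1, h2, h3, Or.inl ⟨rfl, rfl⟩⟩
    · exact ⟨c, a, d, b, h1, h2, h3, Or.inr ⟨rfl, rfl⟩⟩

theorem Crosses.symm {N : ℕ} {d e : Sym2 (Fin N)} (h : Crosses d e) : Crosses e d := by
  obtain ⟨p, q, r, s, h1, h2, h3, h4 | h4⟩ := h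
  · exact ⟨p, q, r, s, h1, h2, h3, Or.inr ⟨h4.2, h4.1⟩⟩
  · exact ⟨p, q, r, s, h1, h2, h3, Or.inl ⟨h4.2, h4.1⟩⟩

theorem IsSide.not_crosses {N : ℕ} {e d : Sym2 (Fin N)} (h : IsSide e) : ¬ Crosses e d := by
  rintro ⟨p, q, r, s, h1, h2, h3, ⟨rfl, -⟩ | ⟨rfl, -⟩⟩
  · rw [isSide_iff _ _ (h1.trans h2)] at h
    rw [Fin.lt_def] at h1 h2 h3
    omega
  · rw [isSide_iff _ _ (h2.trans h3)] at h
    rw [Fin.lt_def] at h1 h2 h3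
    omega

/-! ### Flips in a quadrilateral. -/

namespace PolygonTriangulation

variable {N : ℕ}

theorem IsEdge.not_crosses {T : PolygonTriangulation N} {e d : Sym2 (Fin N)} (h : T.IsEdge e)
    (hd : d ∈ T.diagonals) : ¬ Crosses e d :=
  h.elim (fun h => T.nonCrossing e h d hd) IsSide.not_crosses

/-- Replacing the diagonal `d` by a diagonal `e` that crosses `d` only. -/
def exchange (T : PolygonTriangulation N) (d e : Sym2 (Fin N)) (hd : d ∈ T.diagonals)
    (he : IsDiagonal e) (hde : Crosses d e)
    (honly : ∀ x ∈ T.diagonals, x ≠ d → ¬ Crosses x e)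
    (huniq : ∀ x, IsDiagonal x → Crosses d x → (∀ y ∈ T.diagonals, y ≠ d → ¬ Crosses y x) →
      x = e) : PolygonTriangulation N where
  three_le := T.three_le
  diagonals := insert e (T.diagonals.erase d)
  isDiagonal := by
    intro x hx
    rcases Finset.mem_insert.1 hx with rfl | hx
    · exact he
    · exact T.isDiagonal x (Finset.mem_of_mem_erase hx)
  nonCrossing := by
    have hself : ¬ Crosses e e := by
      obtain ⟨a, b, hab, rfl⟩ := exists_lt_of_not_isDiag e he.1
      rw [crosses_iff hab hab]
      simp
    intro x hx y hy
    rcases Finset.mem_insert.1 hx with rfl | hx <;> rcases Finset.mem_insert.1 hy with hy | hy <;>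
      try subst hy
    · exact hself
    · exact fun h => honly y (Finset.mem_of_mem_erase hy) (Finset.ne_of_mem_erase hy) h.symm
    · exact honly x (Finset.mem_of_mem_erase ‹_›) (Finset.ne_of_mem_erase ‹_›)
    · exact T.nonCrossing x (Finset.mem_of_mem_erase hx) y (Finset.mem_of_mem_erase hy)
  maximal := by
    intro x hx hc
    have h1 : ∀ y ∈ T.diagonals, y ≠ d → ¬ Crosses y x := fun y hy hyd =>
      hc y (Finset.mem_insert_of_mem (Finset.mem_erase.2 ⟨hyd, hy⟩))
    by_cases hdx : Crosses d x
    · rw [huniq x hx hdx h1]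
      exact Finset.mem_insert_self _ _
    · have hxT : x ∈ T.diagonals := T.maximal x hx fun y hy => by
        by_cases hyd : y = d
        · rwa [hyd]
        · exact h1 y hy hyd
      have hxd : x ≠ d := by
        rintro rfl
        exact hc e (Finset.mem_insert_self _ _) hde.symm
      exact Finset.mem_insert_of_mem (Finset.mem_erase.2 ⟨hxd, hxT⟩)

/-- In a quadrilateral `pqrs` of edges of `T`, one diagonal of which belongs to `T`, this diagonal
can be flipped. -/
theorem exists_isFlip (T : PolygonTriangulation N) {p q r s : Fin N} (h1 : p < q) (h2 : q < r)
    (h3 : r < s) (e1 : T.IsEdge s(p, q)) (e2 : T.IsEdge s(q, r)) (e3 : T.IsEdge s(r, s))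
    (e4 : T.IsEdge s(p, s)) :
    (s(p, r) ∈ T.diagonals → ∃ T' : PolygonTriangulation N, T.IsFlip T' ∧
      T'.diagonals = insert s(q, s) (T.diagonals.erase s(p, r))) ∧
    (s(q, s) ∈ T.diagonals → ∃ T' : PolygonTriangulation N, T.IsFlip T' ∧
      T'.diagonals = insert s(p, r) (T.diagonals.erase s(q, s))) := by
  have hs := s.isLt
  have hpr := h1.trans h2
  have hqs := h2.trans h3
  have hps := hpr.trans h3
  -- A diagonal that crosses no side of the quadrilateral but crosses one of its two diagonals must
  -- be the other one. This gives both `only` (for members of `T`) and `uniq` (for a candidate that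
  -- crosses only `d`).
  have only : ∀ x ∈ T.diagonals,
      (x ≠ s(p, r) → ¬ Crosses x s(q, s) ∨ s(q, s) ∈ T.diagonals) ∧
      (x ≠ s(q, s) → ¬ Crosses x s(p, r) ∨ s(p, r) ∈ T.diagonals) := by
    intro x hx
    have c1 := e1.not_crosses hx
    have c2 := e2.not_crosses hx
    have c3 := e3.not_crosses hx
    have c4 := e4.not_crosses hx
    obtain ⟨a, b, hab, rfl⟩ := exists_lt_of_not_isDiag x (T.isDiagonal x hx).1
    rw [crosses_iff h1 hab] at c1
    rw [crosses_iff h2 hab] at c2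
    rw [crosses_iff h3 hab] at c3
    rw [crosses_iff hps hab] at c4
    rw [crosses_iff hab hqs, crosses_iff hab hpr, ne_eq, ne_eq, sym2_mk_eq_iff_of_lt hab hpr,
      sym2_mk_eq_iff_of_lt hab hqs]
    simp only [Fin.lt_def, Fin.ext_iff] at *
    constructor <;> intro h <;> left <;> omega
  have uniq : ∀ d, d = s(p, r) ∨ d = s(q, s) → ∀ x, IsDiagonal x → Crosses d x →
      (∀ y ∈ T.diagonals, y ≠ d → ¬ Crosses y x) →
      (d = s(p, r) → x = s(q, s)) ∧ (d = s(q, s) → x = s(p, r)) := by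
    intro d hd x hx hdx hy
    obtain ⟨a, b, hab, rfl⟩ := exists_lt_of_not_isDiag x hx.1
    have c : ∀ e, T.IsEdge e → e ≠ d → ¬ Crosses e s(a, b) := fun e he hed =>
      he.elim (fun h => hy e h hed) IsSide.not_crosses
    have c1 := c _ e1
    have c2 := c _ e2
    have c3 := c _ e3
    have c4 := c _ e4
    rw [crosses_iff h1 hab] at c1
    rw [crosses_iff h2 hab] at c2
    rw [crosses_iff h3 hab] at c3
    rw [crosses_iff hps hab] at c4
    rw [sym2_mk_eq_iff_of_lt hab hpr, sym2_mk_eq_iff_of_lt hab hqs]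
    rcases hd with rfl | rfl
    · rw [ne_eq, sym2_mk_eq_iff_of_lt (by assumption) (by assumption)] at c1 c2 c3 c4
      rw [crosses_iff hpr hab] at hdx
      rw [sym2_mk_eq_iff_of_lt hpr hqs]
      simp only [Fin.lt_def, Fin.ext_iff] at *
      omega
    · rw [ne_eq, sym2_mk_eq_iff_of_lt (by assumption) (by assumption)] at c1 c2 c3 c4
      rw [crosses_iff hqs hab] at hdx
      rw [sym2_mk_eq_iff_of_lt hqs hpr]
      simp only [Fin.lt_def, Fin.ext_iff] at *
      omega
  have hcr : Crosses s(p, r) s(q, s) := (crosses_iff hpr hqs).2 (Or.inl ⟨h1, h2, h3⟩)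
  constructor
  · intro hd
    refine ⟨T.exchange s(p, r) s(q, s) hd ?_ hcr ?_ ?_, ⟨p, q, r, s, h1, h2, h3, e1, e2, e3, e4,
      Or.inl ⟨hd, rfl⟩⟩, rfl⟩
    · rw [isDiagonal_iff q s hqs]
      simp only [Fin.lt_def] at *
      omega
    · exact fun x hx hxd => ((only x hx).1 hxd).resolve_right fun h =>
        T.nonCrossing _ hd _ h hcr
    · exact fun x hx hdx hy => (uniq _ (Or.inl rfl) x hx hdx hy).1 rfl
  · intro hd
    refine ⟨T.exchange s(q, s) s(p, r) hd ?_ hcr.symm ?_ ?_, ⟨p, q, r, s, h1, h2, h3, e1, e2, e3,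
      e4, Or.inr ⟨hd, rfl⟩⟩, rfl⟩
    · rw [isDiagonal_iff p r hpr]
      simp only [Fin.lt_def] at *
      omega
    · exact fun x hx hxd => ((only x hx).2 hxd).resolve_right fun h =>
        T.nonCrossing _ hd _ h hcr.symm
    · exact fun x hx hdx hy => (uniq _ (Or.inr rfl) x hx hdx hy).2 rfl

/-- A flip exchanges one diagonal. -/
theorem IsFlip.exists_exchange {T T' : PolygonTriangulation N} (h : T.IsFlip T') :
    ∃ d e, d ∈ T.diagonals ∧ e ∉ T.diagonals ∧ T'.diagonals = insert e (T.diagonals.erase d) := by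
  obtain ⟨p, q, r, s, h1, h2, h3, -, -, -, -, h⟩ := h
  have hcr : Crosses s(p, r) s(q, s) :=
    (crosses_iff (h1.trans h2) (h2.trans h3)).2 (Or.inl ⟨h1, h2, h3⟩)
  rcases h with ⟨h4, h5⟩ | ⟨h4, h5⟩
  · exact ⟨_, _, h4, fun h => T.nonCrossing _ h4 _ h hcr, h5⟩
  · exact ⟨_, _, h4, fun h => T.nonCrossing _ h _ h4 hcr, h5⟩

theorem IsFlip.ne {T T' : PolygonTriangulation N} (h : T.IsFlip T') : T ≠ T' := by
  obtain ⟨d, e, -, he, h'⟩ := h.exists_exchange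
  rintro rfl
  exact he (h' ▸ Finset.mem_insert_self _ _)

theorem IsFlip.sdiff_card_le {T T' : PolygonTriangulation N} (h : T.IsFlip T') :
    (T.diagonals \ T'.diagonals).card ≤ 1 ∧ (T'.diagonals \ T.diagonals).card ≤ 1 := by
  obtain ⟨d, e, hd, he, h'⟩ := h.exists_exchange
  constructor
  · rw [← Finset.card_singleton d]
    refine Finset.card_le_card fun x hx => ?_
    simp only [h', Finset.mem_sdiff, Finset.mem_insert, Finset.mem_erase] at hx
    simp only [Finset.mem_singleton]
    tauto
  · rw [← Finset.card_singleton e]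
    refine Finset.card_le_card fun x hx => ?_
    simp only [h', Finset.mem_sdiff, Finset.mem_insert, Finset.mem_erase] at hx
    simp only [Finset.mem_singleton]
    tauto

end PolygonTriangulation

/-! ### Lower bound for the flip distance. -/

open PolygonTriangulation

theorem flipGraph_adj_of_isFlip {N : ℕ} {T T' : PolygonTriangulation N} (h : T.IsFlip T') :
    (flipGraph N).Adj T T' :=
  (SimpleGraph.fromRel_adj _ _ _).2 ⟨h.ne, Or.inl h⟩

theorem sdiff_card_le_of_flipGraph_adj {N : ℕ} {T T' : PolygonTriangulation N}
    (h : (flipGraph N).Adj T T') :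
    (T.diagonals \ T'.diagonals).card ≤ 1 ∧ (T'.diagonals \ T.diagonals).card ≤ 1 := by
  rcases ((SimpleGraph.fromRel_adj _ _ _).1 h).2 with h | h
  · exact h.sdiff_card_le
  · exact h.sdiff_card_le.symm

/-- If every diagonal of `T'` is crossed by all but at most `c` of the diagonals of `T`, then
a flip path from `T` to `T'` can exchange diagonals of `T` directly for diagonals of `T'` in at
most `c + 1` of its steps. -/
theorem card_add_card_le_walk_length {N c : ℕ} {T T' : PolygonTriangulation N}
    (hdisj : Disjoint T.diagonals T'.diagonals)
    (hc : ∀ f ∈ T'.diagonals, ∃ S : Finset (Sym2 (Fin N)), S.card ≤ c ∧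
      ∀ e ∈ T.diagonals, ¬ Crosses e f → e ∈ S)
    (p : (flipGraph N).Walk T T') :
    T.diagonals.card + T'.diagonals.card ≤ p.length + (c + 1) := by
  classical
  set m := p.length with hm
  have adj : ∀ i < m, (flipGraph N).Adj (p.getVert i) (p.getVert (i + 1)) :=
    fun i hi => p.adj_getVert_succ hi
  -- The flip at which `e` disappears for the first time; `e` is present at all earlier times. It
  -- may reappear later.
  have rem : ∀ e ∈ T.diagonals, ∃ i < m, (∀ j ≤ i, e ∈ (p.getVert j).diagonals) ∧
      e ∉ (p.getVert (i + 1)).diagonals := by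
    intro e he
    have hex : ∃ i, e ∉ (p.getVert i).diagonals :=
      ⟨m, by rw [hm, p.getVert_length]; exact Finset.disjoint_left.1 hdisj he⟩
    have h0 : Nat.find hex ≠ 0 := by
      intro h
      have := Nat.find_spec hex
      rw [h, p.getVert_zero] at this
      exact this he
    obtain ⟨i, hi⟩ := Nat.exists_eq_succ_of_ne_zero h0
    have hle : Nat.find hex ≤ m :=
      Nat.find_min' hex (by rw [hm, p.getVert_length]; exact Finset.disjoint_left.1 hdisj he)
    refine ⟨i, by omega, fun j hj => ?_, ?_⟩
    · by_contra h
      have := Nat.find_min' hex h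
      omega
    · have := Nat.find_spec hex
      rwa [hi] at this
  -- The flip at which `f` is created for good, that is, for the last time. As `getVert` is constant
  -- beyond the end of the walk, "for all later times" needs no upper bound.
  have cre : ∀ f ∈ T'.diagonals, ∃ i < m, (∀ j, i < j → f ∈ (p.getVert j).diagonals) ∧
      f ∉ (p.getVert i).diagonals := by
    intro f hf
    have hex : ∃ i, ∀ j, i ≤ j → f ∈ (p.getVert j).diagonals :=
      ⟨m, fun j hj => by rwa [p.getVert_of_length_le hj]⟩
    have h0 : Nat.find hex ≠ 0 := by
      intro h
      have := Nat.find_spec hex 0 (by omega)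
      rw [p.getVert_zero] at this
      exact Finset.disjoint_left.1 hdisj this hf
    obtain ⟨i, hi⟩ := Nat.exists_eq_succ_of_ne_zero h0
    have hle : Nat.find hex ≤ m :=
      Nat.find_min' hex (fun j hj => by rwa [p.getVert_of_length_le hj])
    have hsp : ∀ j, i < j → f ∈ (p.getVert j).diagonals := fun j hj =>
      Nat.find_spec hex j (by omega)
    refine ⟨i, by omega, hsp, fun h => ?_⟩
    have := Nat.find_min' hex (m := i) fun j hj => by
      rcases hj.eq_or_lt with rfl | hj
      · exact h
      · exact hsp j hj
    omega
  choose! ρ hρ hρ1 hρ2 using rem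
  choose! σ hσ hσ1 hσ2 using cre
  have ρinj : Set.InjOn ρ T.diagonals := by
    intro e he e' he' h
    refine Finset.card_le_one.1 (sdiff_card_le_of_flipGraph_adj (adj _ (hρ e he))).1 e ?_ e' ?_
    · exact Finset.mem_sdiff.2 ⟨hρ1 e he _ le_rfl, hρ2 e he⟩
    · exact Finset.mem_sdiff.2 ⟨hρ1 e' he' _ h.le, h ▸ hρ2 e' he'⟩
  have σinj : Set.InjOn σ T'.diagonals := by
    intro e he e' he' h
    refine Finset.card_le_one.1 (sdiff_card_le_of_flipGraph_adj (adj _ (hσ e he))).2 e ?_ e' ?_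
    · exact Finset.mem_sdiff.2 ⟨hσ1 e he _ (by omega), hσ2 e he⟩
    · exact Finset.mem_sdiff.2 ⟨hσ1 e' he' _ (by omega), h ▸ hσ2 e' he'⟩
  set R := T.diagonals.image ρ with hR
  set S := T'.diagonals.image σ with hS
  have hRc : R.card = T.diagonals.card := Finset.card_image_of_injOn ρinj
  have hSc : S.card = T'.diagonals.card := Finset.card_image_of_injOn σinj
  have hU : (R ∪ S).card ≤ m := by
    rw [← Finset.card_range m]
    refine Finset.card_le_card fun i hi => ?_
    rcases Finset.mem_union.1 hi with hi | hi
    · obtain ⟨e, he, rfl⟩ := Finset.mem_image.1 hi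
      exact Finset.mem_range.2 (hρ e he)
    · obtain ⟨e, he, rfl⟩ := Finset.mem_image.1 hi
      exact Finset.mem_range.2 (hσ e he)
  -- Let `t` be the earliest step in both sets and `f` the diagonal created for good there. A
  -- diagonal `e` with `t < ρ e` is still present together with `f`, so it does not cross `f`; there
  -- are at most `c` of these, and `t` itself accounts for the extra one.
  have hI : (R ∩ S).card ≤ c + 1 := by
    rcases (R ∩ S).eq_empty_or_nonempty with h | h
    · simp [h]
    · set t := (R ∩ S).min' h with ht
      have htm := Finset.min'_mem _ h
      rw [← ht] at htm
      obtain ⟨f, hf, hft⟩ := Finset.mem_image.1 (Finset.mem_inter.1 htm).2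
      obtain ⟨X, hX, hX'⟩ := hc f hf
      have hsub : (R ∩ S).erase t ⊆
          X.image ρ := by
        intro t' ht'
        obtain ⟨e, he, rfl⟩ := Finset.mem_image.1
          (Finset.mem_inter.1 (Finset.mem_of_mem_erase ht')).1
        refine Finset.mem_image_of_mem _ (hX' e he ?_)
        have hlt : t < ρ e := lt_of_le_of_ne
          (Finset.min'_le _ _ (Finset.mem_of_mem_erase ht')) (Finset.ne_of_mem_erase ht').symm
        exact (p.getVert (ρ e)).nonCrossing e (hρ1 e he _ le_rfl) f
          (hσ1 f hf _ (hft ▸ hlt))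
      have h1 := (Finset.card_le_card hsub).trans Finset.card_image_le
      have h3 := Finset.card_erase_add_one htm
      omega
  have := Finset.card_union_add_card_inter R S
  omega

theorem mem_triPlus_diagonals {n : ℕ} {a b : Fin (2 * n + 4)} (h : a < b) :
    s(a, b) ∈ (triPlus n).diagonals ↔
      (a.val = 0 ∧ n + 2 ≤ b.val ∧ b.val ≤ 2 * n + 2) ∨
      (1 ≤ a.val ∧ a.val ≤ n ∧ b.val = n + 2) :=
  mem_diagonalsPlus n a b h

theorem mem_triMinus_diagonals {n : ℕ} {a b : Fin (2 * n + 4)} (h : a < b) :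
    s(a, b) ∈ (triMinus n).diagonals ↔
      (a.val = n + 1 ∧ n + 3 ≤ b.val) ∨
      (1 ≤ a.val ∧ a.val ≤ n ∧ b.val = 2 * n + 3) :=
  mem_diagonalsMinus n a b h

theorem disjoint_triPlus_triMinus (n : ℕ) :
    Disjoint (triPlus n).diagonals (triMinus n).diagonals := by
  refine Finset.disjoint_left.2 fun e he he' => ?_
  obtain ⟨a, b, hab, rfl⟩ := exists_lt_of_not_isDiag e ((triPlus n).isDiagonal e he).1
  rw [mem_triPlus_diagonals hab] at he
  rw [mem_triMinus_diagonals hab] at he'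
  omega

theorem le_card_triPlus (n : ℕ) : 2 * n + 1 ≤ (triPlus n).diagonals.card := by
  let a : Fin (2 * n + 1) → Fin (2 * n + 4) := fun i =>
    ⟨if i.val ≤ n then 0 else i.val - n, by split_ifs <;> omega⟩
  let b : Fin (2 * n + 1) → Fin (2 * n + 4) := fun i =>
    ⟨if i.val ≤ n then n + 2 + i.val else n + 2, by split_ifs <;> omega⟩
  have hab : ∀ i, a i < b i := fun i => by
    simp only [a, b, Fin.lt_def]; split_ifs <;> omega
  have := Finset.card_le_card_of_injOn (s := Finset.univ) (t := (triPlus n).diagonals)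
    (fun i => s(a i, b i)) (fun i _ => by
      simp only [Finset.mem_coe]
      rw [mem_triPlus_diagonals (hab i)]
      simp only [a, b]
      split_ifs <;> omega) (fun i _ j _ h => by
      simp only at h
      rw [sym2_mk_eq_iff_of_lt (hab i) (hab j)] at h
      simp only [a, b, Fin.ext_iff] at h ⊢
      split_ifs at h <;> omega)
  simpa using this

theorem le_card_triMinus (n : ℕ) : 2 * n + 1 ≤ (triMinus n).diagonals.card := by
  let a : Fin (2 * n + 1) → Fin (2 * n + 4) := fun i =>
    ⟨if i.val ≤ n then n + 1 else i.val - n, by split_ifs <;> omega⟩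
  let b : Fin (2 * n + 1) → Fin (2 * n + 4) := fun i =>
    ⟨if i.val ≤ n then n + 3 + i.val else 2 * n + 3, by split_ifs <;> omega⟩
  have hab : ∀ i, a i < b i := fun i => by
    simp only [a, b, Fin.lt_def]; split_ifs <;> omega
  have := Finset.card_le_card_of_injOn (s := Finset.univ) (t := (triMinus n).diagonals)
    (fun i => s(a i, b i)) (fun i _ => by
      simp only [Finset.mem_coe]
      rw [mem_triMinus_diagonals (hab i)]
      simp only [a, b]
      split_ifs <;> omega) (fun i _ j _ h => by
      simp only at h
      rw [sym2_mk_eq_iff_of_lt (hab i) (hab j)] at h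
      simp only [a, b, Fin.ext_iff] at h ⊢
      split_ifs at h <;> omega)
  simpa using this

/-- A diagonal at $A$ crosses $BC$ and every $Cv_j$, so only the $n$ diagonals $Bu_i$ can miss it. A
diagonal $Dv_j$ crosses $BC$ and every $Bu_i$, so only the $n$ diagonals at $C$ to the $v_j$ can
miss it. -/
theorem exists_finset_of_mem_triMinus {n : ℕ} {f : Sym2 (Fin (2 * n + 4))}
    (hf : f ∈ (triMinus n).diagonals) : ∃ S : Finset (Sym2 (Fin (2 * n + 4))), S.card ≤ n ∧
      ∀ e ∈ (triPlus n).diagonals, ¬ Crosses e f → e ∈ S := by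
  obtain ⟨c, d, hcd, rfl⟩ := exists_lt_of_not_isDiag f ((triMinus n).isDiagonal f hf).1
  rw [mem_triMinus_diagonals hcd] at hf
  have hd := d.isLt
  rcases hf with hf | hf
  · refine ⟨Finset.univ.image fun i : Fin n =>
      s(⟨0, by omega⟩, ⟨n + 3 + i.val, by omega⟩), ?_, fun e he h => ?_⟩
    · exact Finset.card_image_le.trans (by simp)
    · obtain ⟨a, b, hab, rfl⟩ := exists_lt_of_not_isDiag e ((triPlus n).isDiagonal e he).1
      rw [mem_triPlus_diagonals hab] at he
      rw [crosses_iff hab hcd] at h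
      rw [Finset.mem_image]
      simp only [Fin.lt_def] at h
      exact ⟨⟨b.val - (n + 3), by omega⟩, Finset.mem_univ _,
        Sym2.eq_iff.2 (Or.inl ⟨Fin.ext (by simp only; omega), Fin.ext (by simp only; omega)⟩)⟩
  · refine ⟨Finset.univ.image fun i : Fin n =>
      s(⟨i.val + 1, by omega⟩, ⟨n + 2, by omega⟩), ?_, fun e he h => ?_⟩
    · exact Finset.card_image_le.trans (by simp)
    · obtain ⟨a, b, hab, rfl⟩ := exists_lt_of_not_isDiag e ((triPlus n).isDiagonal e he).1
      rw [mem_triPlus_diagonals hab] at he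
      rw [crosses_iff hab hcd] at h
      rw [Finset.mem_image]
      simp only [Fin.lt_def] at h
      exact ⟨⟨a.val - 1, by omega⟩, Finset.mem_univ _,
        Sym2.eq_iff.2 (Or.inl ⟨Fin.ext (by simp only; omega), Fin.ext (by simp only; omega)⟩)⟩

theorem le_walk_length (n : ℕ) (p : (flipGraph (2 * n + 4)).Walk (triPlus n) (triMinus n)) :
    3 * n + 1 ≤ p.length := by
  have h := card_add_card_le_walk_length (disjoint_triPlus_triMinus n)
    (fun f hf => exists_finset_of_mem_triMinus hf) p
  have := le_card_triPlus n
  have := le_card_triMinus n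
  omega

/-! ### A flip path of length $3n+1$. -/

/-- There is a triangulation at the end of a walk of `t` flips from `T` whose diagonals are
described by `P`. -/
def ReachesIn {N : ℕ} (T : PolygonTriangulation N) (t : ℕ) (P : ℕ → ℕ → Prop) : Prop :=
  ∃ (T' : PolygonTriangulation N) (p : (flipGraph N).Walk T T'), p.length = t ∧
    ∀ a b : Fin N, a < b → (s(a, b) ∈ T'.diagonals ↔ P a.val b.val)

/-- Reduces a flip to arithmetic with vertex numbers. Since `p < q < r < s`, the side from `0` to `N
- 1` can only occur as the edge `ps`; the other three edges are sides only if their ends are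
consecutive. -/
theorem ReachesIn.step {N : ℕ} {T : PolygonTriangulation N} {t : ℕ} {P P' : ℕ → ℕ → Prop}
    (h : ReachesIn T t P) (p q r s : ℕ) (h1 : p < q) (h2 : q < r) (h3 : r < s) (hs : s < N)
    (e1 : P p q ∨ q = p + 1) (e2 : P q r ∨ r = q + 1) (e3 : P r s ∨ s = r + 1)
    (e4 : P p s ∨ (p = 0 ∧ s + 1 = N))
    (hP : (P p r ∧ ∀ a b, a < b → b < N →
        (P' a b ↔ (a = q ∧ b = s) ∨ (P a b ∧ ¬ (a = p ∧ b = r)))) ∨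
      (P q s ∧ ∀ a b, a < b → b < N →
        (P' a b ↔ (a = p ∧ b = r) ∨ (P a b ∧ ¬ (a = q ∧ b = s))))) :
    ReachesIn T (t + 1) P' := by
  obtain ⟨T₁, w, hw, hT₁⟩ := h
  have edge : ∀ x y : Fin N, x < y → (P x.val y.val ∨ y.val = x.val + 1 ∨
      (x.val = 0 ∧ y.val + 1 = N)) → T₁.IsEdge s(x, y) := fun x y hxy h => by
    rcases h with h | h
    · exact Or.inl ((hT₁ x y hxy).2 h)
    · exact Or.inr ((isSide_iff x y hxy).2 h)
  have g1 : (⟨p, by omega⟩ : Fin N) < ⟨q, by omega⟩ := h1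
  have g2 : (⟨q, by omega⟩ : Fin N) < ⟨r, by omega⟩ := h2
  have g3 : (⟨r, by omega⟩ : Fin N) < ⟨s, by omega⟩ := h3
  obtain ⟨f1, f2⟩ := T₁.exists_isFlip g1 g2 g3 (edge _ _ g1 (e1.imp_right Or.inl))
    (edge _ _ g2 (e2.imp_right Or.inl)) (edge _ _ g3 (e3.imp_right Or.inl))
    (edge _ _ (g1.trans (g2.trans g3)) (e4.imp_right Or.inr))
  rcases hP with ⟨hd, hP⟩ | ⟨hd, hP⟩
  · obtain ⟨T₂, hf, hT₂⟩ := f1 ((hT₁ _ _ (g1.trans g2)).2 hd)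
    refine ⟨T₂, w.concat (flipGraph_adj_of_isFlip hf), by simp [hw], fun a b hab => ?_⟩
    rw [hT₂, Finset.mem_insert, Finset.mem_erase, ne_eq, sym2_mk_eq_iff_of_lt hab (g2.trans g3),
      sym2_mk_eq_iff_of_lt hab (g1.trans g2), hT₁ a b hab, hP _ _ hab b.isLt]
    simp only [Fin.ext_iff]
    exact or_congr Iff.rfl and_comm
  · obtain ⟨T₂, hf, hT₂⟩ := f2 ((hT₁ _ _ (g2.trans g3)).2 hd)
    refine ⟨T₂, w.concat (flipGraph_adj_of_isFlip hf), by simp [hw], fun a b hab => ?_⟩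
    rw [hT₂, Finset.mem_insert, Finset.mem_erase, ne_eq, sym2_mk_eq_iff_of_lt hab (g2.trans g3),
      sym2_mk_eq_iff_of_lt hab (g1.trans g2), hT₁ a b hab, hP _ _ hab b.isLt]
    simp only [Fin.ext_iff]
    exact or_congr Iff.rfl and_comm

theorem ReachesIn.congr {N : ℕ} {T : PolygonTriangulation N} {t t' : ℕ} {P P' : ℕ → ℕ → Prop}
    (h : ReachesIn T t P) (ht : t = t') (hP : ∀ a b, a < b → b < N → (P a b ↔ P' a b)) :
    ReachesIn T t' P' := by
  subst ht
  obtain ⟨T₁, w, hw, hT₁⟩ := h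
  exact ⟨T₁, w, hw, fun a b hab => (hT₁ a b hab).trans (hP _ _ hab b.isLt)⟩

/-- The diagonals at `C` are flipped to diagonals at `B`. -/
theorem reachesIn_fan (n j : ℕ) (hj : j ≤ n) : ReachesIn (triPlus n) j fun a b =>
    (a = 0 ∧ n + 2 ≤ b ∧ b ≤ 2 * n + 2) ∨ (a = 0 ∧ 2 ≤ b ∧ b ≤ j + 1) ∨
      (j + 1 ≤ a ∧ a ≤ n ∧ b = n + 2) := by
  induction j with
  | zero =>
    refine ⟨triPlus n, .nil, rfl, fun a b hab => ?_⟩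
    rw [mem_triPlus_diagonals hab]
    omega
  | succ j ih =>
    -- In the quadrilateral $B\,v_{j+1}\,v_{j+2}\,C$, where $v_{n+1}$ stands for $A$, the diagonal
    -- $Cv_{j+1}$ becomes $Bv_{j+2}$.
    refine (ih (by omega)).step 0 (j + 1) (j + 2) (n + 2) (by omega) (by omega) (by omega)
      (by omega) (by omega) (by omega) (by omega) (by omega) (Or.inr ⟨by omega, ?_⟩)
    intro a b hab hb
    omega

/-- The diagonals from `B` to `C` and the `u_i` are flipped to diagonals at `A`. -/
theorem reachesIn_shift (n i : ℕ) (hi : i ≤ n + 1) : ReachesIn (triPlus n) (n + i) fun a b =>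
    (a = 0 ∧ 2 ≤ b ∧ b ≤ n + 1) ∨ (a = 0 ∧ n + 2 + i ≤ b ∧ b ≤ 2 * n + 2) ∨
      (a = n + 1 ∧ n + 3 ≤ b ∧ b ≤ n + 2 + i) := by
  induction i with
  | zero =>
    refine (reachesIn_fan n n le_rfl).congr rfl fun a b hab hb => ?_
    omega
  | succ i ih =>
    refine (ih (by omega)).step 0 (n + 1) (n + 2 + i) (n + 3 + i) (by omega) (by omega) (by omega)
      (by omega) (by omega) (by omega) (by omega) (by omega) (Or.inl ⟨by omega, ?_⟩)
    intro a b hab hb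
    omega

/-- The diagonals from `B` to `A` and the `v_j` are flipped to diagonals at `D`. -/
theorem reachesIn_unfan (n j : ℕ) (hj : j ≤ n) : ReachesIn (triPlus n) (2 * n + 1 + j) fun a b =>
    (a = n + 1 ∧ n + 3 ≤ b) ∨ (a = 0 ∧ 2 ≤ b ∧ b ≤ n + 1 - j) ∨
      (n + 1 - j ≤ a ∧ a ≤ n ∧ b = 2 * n + 3) := by
  induction j with
  | zero =>
    refine (reachesIn_shift n (n + 1) le_rfl).congr (by omega) fun a b hab hb => ?_
    omega
  | succ j ih =>
    refine (ih (by omega)).step 0 (n - j) (n + 1 - j) (2 * n + 3) (by omega) (by omega)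
      (by omega) (by omega) (by omega) (by omega) (by omega) (by omega) (Or.inl ⟨by omega, ?_⟩)
    intro a b hab hb
    omega

theorem flipDist_triPlus_triMinus (n : ℕ) : flipDist (triPlus n) (triMinus n) = 3 * n + 1 := by
  obtain ⟨T, w, hw, hT⟩ := reachesIn_unfan n n le_rfl
  have hTeq : T = triMinus n := by
    refine PolygonTriangulation.ext (Finset.ext fun e => ?_)
    constructor
    · intro he
      obtain ⟨a, b, hab, rfl⟩ := exists_lt_of_not_isDiag e (T.isDiagonal e he).1
      rw [mem_triMinus_diagonals hab]
      rw [hT a b hab] at he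
      omega
    · intro he
      obtain ⟨a, b, hab, rfl⟩ := exists_lt_of_not_isDiag e ((triMinus n).isDiagonal e he).1
      rw [mem_triMinus_diagonals hab] at he
      rw [hT a b hab]
      omega
  subst hTeq
  obtain ⟨p, hp⟩ := w.reachable.exists_walk_length_eq_dist
  have h1 := le_walk_length n p
  have h2 := SimpleGraph.dist_le w
  rw [flipDist]
  omega

/-! ### Labels on the boundary of a decomposition. -/

/-- The upper disc, for `b = true`, or the lower disc is mapped to the sphere. -/
def GluedSphere.incl {N : ℕ} (T T' : PolygonTriangulation N) :
    (b : Bool) → (cond b T T').disc → GluedSphere T T'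
  | true => fun w => Quot.mk _ (Sum.inl w)
  | false => fun w => Quot.mk _ (Sum.inr w)

/-- The barycentric coordinates of a point of the sphere. -/
def GluedSphere.weight {N : ℕ} {T T' : PolygonTriangulation N} : GluedSphere T T' → Fin N → ℝ :=
  Quot.lift (Sum.elim Subtype.val Subtype.val) (by
    rintro (w | w) (w' | w') h
    · exact h.elim
    · exact h.1
    · exact h.elim
    · exact h.elim)

theorem GluedSphere.weight_incl {N : ℕ} (T T' : PolygonTriangulation N) (b : Bool)
    (w : (cond b T T').disc) : (GluedSphere.incl T T' b w).weight = w.1 := by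
  cases b <;> rfl

/-- The vertex `k` of the standard tetrahedron. -/
def tetVertex (k : Fin 4) : stdSimplex ℝ (Fin 4) :=
  ⟨Pi.single k 1, single_mem_stdSimplex ℝ k⟩

theorem single_mem_disc {N : ℕ} (T : PolygonTriangulation N) {t : Finset (Fin N)}
    (ht : T.IsTriangle t) {v : Fin N} (hv : v ∈ t) : (Pi.single v 1 : Fin N → ℝ) ∈ T.disc :=
  ⟨single_mem_stdSimplex ℝ v, t, ht, fun k hk => Pi.single_eq_of_ne
    (show k ≠ v from fun h => hk (h ▸ hv)) _⟩

namespace TetGluing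

variable {m N : ℕ} {G : TetGluing m} {T T' : PolygonTriangulation N}

/-- The vertex `k` of the tetrahedron `i` is the vertex `v` of the sphere. -/
def IsLabel (G : TetGluing m) (Φ : GluedSphere T T' → G.Space) (i : Fin m) (k : Fin 4)
    (v : Fin N) : Prop :=
  ∃ z, z.weight = Pi.single v 1 ∧ Φ z = Quot.mk G.Rel (i, tetVertex k)

/-- This is where injectivity of `Φ` prevents the gluing from identifying two vertices of the
sphere. A vertex of a tetrahedron in the interior of the ball need not have a label. -/
theorem IsLabel.unique {Φ : GluedSphere T T' → G.Space} (hΦ : Function.Injective Φ) {i : Fin m}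
    {k : Fin 4} {v v' : Fin N} (h : G.IsLabel Φ i k v) (h' : G.IsLabel Φ i k v') : v = v' := by
  obtain ⟨z, hz, e⟩ := h
  obtain ⟨z', hz', e'⟩ := h'
  have := hΦ (e.trans e'.symm)
  subst this
  by_contra hne
  have h1 := congrFun (hz.symm.trans hz') v
  rw [Pi.single_eq_same, Pi.single_eq_of_ne hne] at h1
  exact one_ne_zero h1

theorem IsLabel.glue {Φ : GluedSphere T T' → G.Space} {i j : Fin m} {k f : Fin 4}
    {p : Equiv.Perm (Fin 4)} {v : Fin N} (h : G.IsLabel Φ i k v) (hg : G.glue i f = some (j, p))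
    (hk : k ≠ f) : G.IsLabel Φ j (p k) v := by
  obtain ⟨z, hz, e⟩ := h
  refine ⟨z, hz, e.trans (Quot.sound ⟨f, p, hg, ?_, fun l => ?_⟩)⟩
  · exact Pi.single_eq_of_ne hk.symm _
  · simp only [tetVertex, Pi.single_apply, p.injective.eq_iff]

/-- A point in the interior of a boundary face is not glued to another point. -/
theorem eq_of_mk_eq_of_interior {i j : Fin m} {f : Fin 4} {x y : stdSimplex ℝ (Fin 4)}
    (hf : G.glue i f = none) (hx : ∀ k, k ≠ f → x.1 k ≠ 0)
    (h : Quot.mk G.Rel (i, x) = Quot.mk G.Rel (j, y)) : (i, x) = (j, y) := by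
  -- The point lies on no face except possibly `f`, and `f` is not glued, so it is neither source
  -- nor target of a gluing. Hence being this point is invariant under `Rel` and descends to the
  -- quotient.
  have hl : ∀ a b, G.Rel a b → (a = (i, x)) = (b = (i, x)) := by
    rintro ⟨a, u⟩ ⟨b, v⟩ ⟨f', p, hg, h0, hp⟩
    simp only at hg h0 hp
    refine propext ⟨fun h => ?_, fun h => ?_⟩
    · exfalso
      obtain ⟨rfl, rfl⟩ := Prod.mk.inj h
      have : f' = f := by
        by_contra hne
        exact hx f' hne h0
      rw [this, hf] at hg
      cases hg
    · exfalso
      obtain ⟨rfl, rfl⟩ := Prod.mk.inj h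
      have : p f' = f := by
        by_contra hne
        exact hx _ hne ((hp f').trans h0)
      have h2 := G.glue_symm _ _ _ _ hg
      rw [this, hf] at h2
      cases h2
  have := congrArg (Quot.lift (fun a => a = (i, x)) hl) h
  exact ((cast this rfl : (j, y) = (i, x))).symm

theorem IsFaceMap.isLabel {Φ : GluedSphere T T' → G.Space} {b : Bool} {t : Finset (Fin N)}
    {i : Fin m} {f : Fin 4} (ht : (cond b T T').IsTriangle t) {e : Fin 4 → Fin N}
    (he : Set.BijOn e {k | k ≠ f} {v | v ∈ t})
    (h : ∀ (w : (cond b T T').disc) (x : stdSimplex ℝ (Fin 4)), (∀ v, v ∉ t → w.1 v = 0) →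
      x.1 f = 0 → (∀ k, k ≠ f → x.1 k = w.1 (e k)) →
      Φ (GluedSphere.incl T T' b w) = Quot.mk G.Rel (i, x)) {k : Fin 4} (hk : k ≠ f) :
    G.IsLabel Φ i k (e k) := by
  have hkt : e k ∈ t := he.mapsTo hk
  refine ⟨_, GluedSphere.weight_incl T T' b ⟨_, single_mem_disc _ ht hkt⟩, h _ _ ?_ ?_ ?_⟩
  · exact fun v hv => Pi.single_eq_of_ne (show v ≠ e k from fun h => hv (h ▸ hkt)) _
  · exact Pi.single_eq_of_ne hk.symm _
  · intro l hl
    simp only [tetVertex, Pi.single_apply, he.injOn.eq_iff hl hk]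

/-- The boundary of a gluing that extends the sphere, in terms of labels. -/
structure BoundaryLabels (G : TetGluing m) (T T' : PolygonTriangulation N) where
  label : Fin m → Fin 4 → Fin N → Prop
  unique : ∀ i k v v', label i k v → label i k v' → v = v'
  glue : ∀ i j f p k v, G.glue i f = some (j, p) → k ≠ f → label i k v → label j (p k) v
  side : Fin m → Fin 4 → Bool
  face : Fin m → Fin 4 → Finset (Fin N)
  isTriangle : ∀ i f, G.glue i f = none → (cond (side i f) T T').IsTriangle (face i f)
  labelled : ∀ i f k, G.glue i f = none → k ≠ f → ∃ v ∈ face i f, label i k v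
  surj : ∀ i f, G.glue i f = none → ∀ v ∈ face i f, ∃ k, k ≠ f ∧ label i k v
  inj : ∀ i f k l v, G.glue i f = none → k ≠ f → l ≠ f → label i k v → label i l v → k = l
  exists_face : ∀ b t, (cond b T T').IsTriangle t →
    ∃ i f, G.glue i f = none ∧ side i f = b ∧ face i f = t
  face_inj : ∀ i j f g, G.glue i f = none → G.glue j g = none → side i f = side j g →
    face i f = face j g → i = j ∧ f = g

/-- Forgets the topology of the embedding and keeps what the counting argument needs: labels at the
vertices, carried along by gluings, and a bijection between unglued faces and triangles of the
sphere. The hypothesis that the discs share no triangle lets the vertex set determine the disc. -/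
theorem Extends.exists_boundaryLabels (hN : ∀ t, T.IsTriangle t → ¬ T'.IsTriangle t)
    (h : G.Extends T T') : Nonempty (G.BoundaryLabels T T') := by
  obtain ⟨Φ, hΦ, h1, h2, h3⟩ := h
  have h4 : ∀ b t, (cond b T T').IsTriangle t → ∃ i f, G.glue i f = none ∧
      G.IsFaceMap (T := cond b T T') (fun w => Φ (GluedSphere.incl T T' b w)) t i f := by
    rintro (_ | _)
    · exact h2
    · exact h1
  have h5 : ∀ i f, ∃ b t, G.glue i f = none → (cond b T T').IsTriangle t ∧
      G.IsFaceMap (T := cond b T T') (fun w => Φ (GluedSphere.incl T T' b w)) t i f := by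
    intro i f
    by_cases hg : G.glue i f = none
    · rcases h3 i f hg with ⟨t, ht⟩ | ⟨t, ht⟩
      · exact ⟨true, t, fun _ => ht⟩
      · exact ⟨false, t, fun _ => ht⟩
    · exact ⟨true, ∅, fun h => absurd h hg⟩
  choose side face h6 using h5
  have h7 : ∀ i f, G.glue i f = none → ∃ e : Fin 4 → Fin N,
      Set.BijOn e {k | k ≠ f} {v | v ∈ face i f} ∧ ∀ k, k ≠ f → G.IsLabel Φ i k (e k) := by
    intro i f hg
    obtain ⟨ht, e, he, h⟩ := h6 i f hg
    exact ⟨e, he, fun k hk => IsFaceMap.isLabel ht he h hk⟩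
  have uni : ∀ i k v v', G.IsLabel Φ i k v → G.IsLabel Φ i k v' → v = v' :=
    fun i k v v' => IsLabel.unique hΦ
  refine ⟨⟨G.IsLabel Φ, uni,
    fun i j f p k v hg hk h => h.glue hg hk, side, face, fun i f hg => (h6 i f hg).1, ?_, ?_, ?_,
    ?_, ?_⟩⟩
  · intro i f k hg hk
    obtain ⟨e, he, hl⟩ := h7 i f hg
    exact ⟨e k, he.mapsTo hk, hl k hk⟩
  · intro i f hg v hv
    obtain ⟨e, he, hl⟩ := h7 i f hg
    obtain ⟨k, hk, rfl⟩ := he.surjOn hv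
    exact ⟨k, hk, hl k hk⟩
  · intro i f k l v hg hk hl hkv hlv
    obtain ⟨e, he, hlab⟩ := h7 i f hg
    refine he.injOn hk hl ?_
    rw [uni i k _ _ (hlab k hk) hkv, uni i l _ _ (hlab l hl) hlv]
  · intro b t ht
    obtain ⟨i, f, hg, e, he, hm⟩ := h4 b t ht
    refine ⟨i, f, hg, ?_⟩
    obtain ⟨e', he', hl'⟩ := h7 i f hg
    -- `side` and `face` were chosen independently, so the face that carries `t` could have been
    -- assigned a different triangle. Both parametrisations label its vertices, and labels are
    -- unique, so they agree.
    have hee' : ∀ k, k ≠ f → e k = e' k := fun k hk =>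
      uni i k _ _ (IsFaceMap.isLabel ht he hm hk) (hl' k hk)
    have htt : face i f = t := by
      ext v
      constructor
      · intro hv
        obtain ⟨k, hk, rfl⟩ := he'.surjOn hv
        rw [← hee' k hk]
        exact he.mapsTo hk
      · intro hv
        obtain ⟨k, hk, rfl⟩ := he.surjOn hv
        rw [hee' k hk]
        exact he'.mapsTo hk
    refine ⟨?_, htt⟩
    have ht' := (h6 i f hg).1
    rw [htt] at ht'
    revert ht ht'
    cases b <;> cases side i f
    · exact fun _ _ => rfl
    · exact fun h h' => absurd h (hN t h')
    · exact fun h h' => absurd h' (hN t h)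
    · exact fun _ _ => rfl
  · intro i j f g hf hg hs ht
    obtain ⟨htri, e, he, hm⟩ := h6 i f hf
    obtain ⟨-, e', he', hm'⟩ := h6 j g hg
    rw [← hs, ← ht] at hm'
    rw [← ht] at he'
    set t := face i f
    have hc : (t.card : ℝ) ≠ 0 := by rw [htri.1]; norm_num
    -- The barycentre of the common triangle goes to the centres of both faces. A point in the
    -- interior of an unglued face is identified with no other, so the faces coincide.
    let w : Fin N → ℝ := fun v => if v ∈ t then (t.card : ℝ)⁻¹ else 0
    have hw0 : ∀ v, v ∉ t → w v = 0 := fun v hv => if_neg hv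
    have hw : w ∈ (cond (side i f) T T').disc := by
      refine ⟨⟨fun v => ?_, ?_⟩, t, htri, hw0⟩
      · simp only [w]; split_ifs <;> positivity
      · simp only [w, Finset.sum_ite_mem, Finset.univ_inter, Finset.sum_const, nsmul_eq_mul]
        exact mul_inv_cancel₀ hc
    have pt : ∀ (f : Fin 4) (e : Fin 4 → Fin N), Set.BijOn e {k | k ≠ f} {v | v ∈ t} →
        ∃ x : stdSimplex ℝ (Fin 4), x.1 f = 0 ∧ (∀ k, k ≠ f → x.1 k = w (e k)) ∧
          ∀ k, k ≠ f → x.1 k ≠ 0 := by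
      intro f e he
      have hwe : ∀ k, k ≠ f → w (e k) = 3⁻¹ := fun k hk => by
        have : e k ∈ t := he.mapsTo hk
        simp only [w, if_pos this, htri.1]
        norm_num
      refine ⟨⟨fun k => if k = f then 0 else 3⁻¹, ⟨fun k => ?_, ?_⟩⟩, ?_, ?_, ?_⟩
      · simp only; split_ifs <;> positivity
      · fin_cases f <;> simp [Fin.sum_univ_four] <;> norm_num
      · simp
      · intro k hk
        simp [hk, hwe k hk]
      · intro k hk
        simp [hk]
    obtain ⟨x, hx0, hx1, hx2⟩ := pt f e he
    obtain ⟨y, hy0, hy1, hy2⟩ := pt g e' he'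
    have h8 := eq_of_mk_eq_of_interior hf hx2
      ((hm ⟨w, hw⟩ x hw0 hx0 hx1).symm.trans (hm' ⟨w, hw⟩ y hw0 hy0 hy1))
    obtain ⟨h9, rfl⟩ := Prod.mk.inj h8
    refine ⟨h9, ?_⟩
    by_contra hne
    exact hx2 g (Ne.symm hne) hy0

/-- Two different vertices are joined by an edge of the sphere. -/
def SphereAdj (T T' : PolygonTriangulation N) (v w : Fin N) : Prop :=
  v ≠ w ∧ (T.IsEdge s(v, w) ∨ T'.IsEdge s(v, w))

theorem BoundaryLabels.adj (B : G.BoundaryLabels T T') {i : Fin m} {f k l : Fin 4} {v w : Fin N}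
    (hg : G.glue i f = none) (hk : k ≠ f) (hl : l ≠ f) (hkl : k ≠ l) (hv : B.label i k v)
    (hw : B.label i l w) : SphereAdj T T' v w := by
  have hne : v ≠ w := by
    rintro rfl
    exact hkl (B.inj i f k l v hg hk hl hv hw)
  refine ⟨hne, ?_⟩
  obtain ⟨v', hv', h1⟩ := B.labelled i f k hg hk
  obtain ⟨w', hw', h2⟩ := B.labelled i f l hg hl
  obtain rfl := B.unique _ _ _ _ hv h1
  obtain rfl := B.unique _ _ _ _ hw h2
  have := (B.isTriangle i f hg).2 v hv' w hw' hne
  revert this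
  cases B.side i f
  · exact Or.inr
  · exact Or.inl

/-! ### Counting boundary faces. -/

/-- A property of the tetrahedra that is inherited by glued tetrahedra holds for all or none. -/
theorem IsBall.forall_of_exists (hG : G.IsBall) {Q : Fin m → Prop}
    (hQ : ∀ i j f p, G.glue i f = some (j, p) → Q i → Q j) {i : Fin m} (hi : Q i) (j : Fin m) :
    Q j := by
  classical
  obtain ⟨h⟩ := hG
  have hball : PreconnectedSpace (Metric.closedBall (0 : EuclideanSpace ℝ (Fin 3)) 1) :=
    Subtype.preconnectedSpace (convex_closedBall _ _).isPreconnected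
  have : PreconnectedSpace G.Space :=
    h.symm.surjective.denseRange.preconnectedSpace h.symm.continuous
  -- Gluings can be reversed, so `Q` is constant on glued points. It defines a continuous map from
  -- the connected ball to `Bool`.
  have hl : ∀ a b : Fin m × stdSimplex ℝ (Fin 4), G.Rel a b →
      (decide (Q a.1) : Bool) = decide (Q b.1) := by
    rintro ⟨a, u⟩ ⟨b, v⟩ ⟨f, p, hg, -⟩
    exact decide_eq_decide.2 ⟨hQ _ _ _ _ hg, hQ _ _ _ _ (G.glue_symm _ _ _ _ hg)⟩
  have hc : Continuous (Quot.lift (fun a => (decide (Q a.1) : Bool)) hl : G.Space → Bool) :=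
    continuous_quot_lift _ ((continuous_of_discreteTopology (f := fun i => decide (Q i))).comp
      continuous_fst)
  have := PreconnectedSpace.constant ‹PreconnectedSpace G.Space› hc
    (x := Quot.mk _ (i, tetVertex 0)) (y := Quot.mk _ (j, tetVertex 0))
  exact (decide_eq_decide.1 this).1 hi

/-- A tetrahedron with three boundary faces would give a $K_4$ in the graph of the sphere, so $2M$
triangles need at least $M$ tetrahedra. With exactly $M$, all tetrahedra would share one edge $cd$,
and the pair $c,d$ would meet every triangle, contrary to `hhit`. -/
theorem lt_of_isBall_of_extends (hcommon : ∀ t, T.IsTriangle t → ¬ T'.IsTriangle t)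
    (hK4 : ∀ v : Fin 4 → Fin N, ¬ ∀ k l, k ≠ l → SphereAdj T T' (v k) (v l))
    (hhit : ∀ c d : Fin N, ∃ b t, (cond b T T').IsTriangle t ∧ c ∉ t ∧ d ∉ t)
    {M : ℕ} (X : Finset (Bool × Finset (Fin N))) (hX : ∀ x ∈ X, (cond x.1 T T').IsTriangle x.2)
    (hM : 0 < M) (hXM : 2 * M ≤ X.card) (hG : G.IsBall) (hE : G.Extends T T') : M < m := by
  classical
  obtain ⟨B⟩ := hE.exists_boundaryLabels hcommon
  let bd : Fin m → Finset (Fin 4) := fun i => Finset.univ.filter fun f => G.glue i f = none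
  have mem_bd : ∀ {i f}, f ∈ bd i ↔ G.glue i f = none := by simp [bd]
  have hbd : ∀ i, (bd i).card ≤ 2 := by
    intro i
    by_contra hc
    -- Among three boundary faces some one contains both of two given vertices `k` and `l`, namely
    -- one opposite to neither. So all vertices are labelled and pairwise adjacent.
    have hex : ∀ k l : Fin 4, ∃ f ∈ bd i, f ≠ k ∧ f ≠ l := by
      intro k l
      by_contra hno
      push Not at hno
      have : bd i ⊆ {k, l} := fun f hf => by
        rw [Finset.mem_insert, Finset.mem_singleton]
        by_cases h : f = k
        · exact Or.inl h
        · exact Or.inr (hno f hf h)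
      exact hc ((Finset.card_le_card this).trans Finset.card_le_two)
    have hlab : ∀ k, ∃ v, B.label i k v := fun k => by
      obtain ⟨f, hf, hfk, -⟩ := hex k k
      obtain ⟨v, -, hv⟩ := B.labelled i f k (mem_bd.1 hf) hfk.symm
      exact ⟨v, hv⟩
    choose v hv using hlab
    refine hK4 v fun k l hkl => ?_
    obtain ⟨f, hf, hfk, hfl⟩ := hex k l
    exact B.adj (mem_bd.1 hf) hfk.symm hfl.symm hkl (hv k) (hv l)
  have hcount : 2 * M ≤ ∑ i, (bd i).card := by
    rw [← Finset.card_sigma]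
    refine hXM.trans ?_
    have hch : ∀ x : Bool × Finset (Fin N), ∃ y : (_ : Fin m) × Fin 4, x ∈ X →
        G.glue y.1 y.2 = none ∧ B.side y.1 y.2 = x.1 ∧ B.face y.1 y.2 = x.2 := by
      intro x
      by_cases hx : x ∈ X
      · obtain ⟨i, f, h⟩ := B.exists_face x.1 x.2 (hX x hx)
        exact ⟨⟨i, f⟩, fun _ => h⟩
      -- Outside `X` the value is irrelevant, but the index type must be inhabited; any boundary
      -- face serves.
      · have hN := T.three_le
        obtain ⟨b, t, ht, -⟩ := hhit ⟨0, by omega⟩ ⟨0, by omega⟩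
        obtain ⟨i, f, -⟩ := B.exists_face b t ht
        exact ⟨⟨i, f⟩, fun h => absurd h hx⟩
    choose φ hφ using hch
    refine Finset.card_le_card_of_injOn φ (fun x hx => ?_) (fun x hx y hy h => ?_)
    · exact Finset.mem_sigma.2 ⟨Finset.mem_univ _, mem_bd.2 (hφ x hx).1⟩
    · obtain ⟨-, h1, h2⟩ := hφ x hx
      obtain ⟨-, h3, h4⟩ := hφ y hy
      rw [← h] at h3 h4
      exact Prod.ext (h1.symm.trans h3) (h2.symm.trans h4)
  by_contra hm
  have hbd2 : ∀ i, (bd i).card = 2 := by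
    have hsum : ∑ i : Fin m, (bd i).card = ∑ _i : Fin m, 2 := by
      refine le_antisymm (Finset.sum_le_sum fun i _ => hbd i) ?_
      rw [Finset.sum_const, Finset.card_univ, Fintype.card_fin, smul_eq_mul]
      omega
    exact fun i => (Finset.sum_eq_sum_iff_of_le fun i _ => hbd i).1 hsum i (Finset.mem_univ i)
  have hm0 : 0 < m := by
    by_contra h0
    have : m = 0 := by omega
    subst this
    simp at hcount
    omega
  -- The vertices `f` and `g`, labelled `c` and `d`, span the only edge of this tetrahedron that
  -- lies on neither boundary face.
  obtain ⟨f, g, hfg, hbd0⟩ := Finset.card_eq_two.1 (hbd2 ⟨0, hm0⟩)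
  have hf : G.glue ⟨0, hm0⟩ f = none := mem_bd.1 (by rw [hbd0]; simp)
  have hg : G.glue ⟨0, hm0⟩ g = none := mem_bd.1 (by rw [hbd0]; simp)
  obtain ⟨c, -, hc⟩ := B.labelled _ g f hg hfg
  obtain ⟨d, -, hd⟩ := B.labelled _ f g hf hfg.symm
  have hlab : ∀ k, ∃ v, B.label ⟨0, hm0⟩ k v := fun k => by
    by_cases hkf : k = f
    · exact ⟨c, hkf ▸ hc⟩
    · obtain ⟨v, -, hv⟩ := B.labelled _ f k hf hkf
      exact ⟨v, hv⟩
  choose v hv using hlab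
  have hvf : v f = c := B.unique _ _ _ _ (hv f) hc
  have hvg : v g = d := B.unique _ _ _ _ (hv g) hd
  -- If the labels agreed, both boundary faces would have the same vertex set, hence be the same
  -- triangle of the same disc, contradicting `face_inj`.
  have hcd : c ≠ d := by
    rintro rfl
    have key : ∀ f' g', G.glue ⟨0, hm0⟩ f' = none → G.glue ⟨0, hm0⟩ g' = none → v f' = v g' →
        f' ≠ g' → B.face ⟨0, hm0⟩ f' ⊆ B.face ⟨0, hm0⟩ g' := by
      intro f' g' hf' hg' hvv hne x hx
      obtain ⟨k, hk, hkx⟩ := B.surj _ f' hf' x hx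
      by_cases hkg : k = g'
      · subst hkg
        obtain ⟨y, hy, hly⟩ := B.labelled _ k f' hg' hne
        rwa [B.unique _ _ _ _ hkx (hv k), ← hvv, B.unique _ _ _ _ (hv f') hly]
      · obtain ⟨y, hy, hly⟩ := B.labelled _ g' k hg' hkg
        rwa [B.unique _ _ _ _ hkx hly]
    have hface := (key f g hf hg (hvf.trans hvg.symm) hfg).antisymm
      (key g f hg hf (hvg.trans hvf.symm) hfg.symm)
    have htf := B.isTriangle _ f hf
    have htg := B.isTriangle _ g hg
    have hside : B.side ⟨0, hm0⟩ f = B.side ⟨0, hm0⟩ g := by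
      rw [hface] at htf
      revert htf htg
      cases B.side ⟨0, hm0⟩ f <;> cases B.side ⟨0, hm0⟩ g
      · exact fun _ _ => rfl
      · exact fun h h' => absurd h (hcommon _ h')
      · exact fun h h' => absurd h' (hcommon _ h)
      · exact fun _ _ => rfl
    exact hfg (B.face_inj _ _ f g hf hg hside hface).2
  -- The other five edges lie on a boundary face, so adjacency of `c` and `d` would complete a
  -- $K_4$.
  have hnadj : ¬ SphereAdj T T' c d := by
    intro hadj
    have hadj' : SphereAdj T T' d c := ⟨hadj.1.symm, by rw [Sym2.eq_swap]; exact hadj.2⟩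
    refine hK4 v fun k l hkl => ?_
    by_cases h1 : k ≠ f ∧ l ≠ f
    · exact B.adj hf h1.1 h1.2 hkl (hv k) (hv l)
    by_cases h2 : k ≠ g ∧ l ≠ g
    · exact B.adj hg h2.1 h2.2 hkl (hv k) (hv l)
    have : (k = f ∧ l = g) ∨ (k = g ∧ l = f) := by
      by_cases hkf : k = f
      · subst hkf
        left
        refine ⟨rfl, ?_⟩
        by_contra hlg
        exact h2 ⟨hfg, hlg⟩
      · right
        have hlf : l = f := by
          by_contra hlf
          exact h1 ⟨hkf, hlf⟩
        subst hlf
        refine ⟨?_, rfl⟩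
        by_contra hkg
        exact h2 ⟨hkg, hfg⟩
    rcases this with ⟨rfl, rfl⟩ | ⟨rfl, rfl⟩
    · rwa [hvf, hvg]
    · rwa [hvf, hvg]
  let Q : Fin m → Prop := fun i => ∃ k l, B.label i k c ∧ B.label i l d
  -- A boundary face containing both vertices would make `c` and `d` adjacent. So the two boundary
  -- faces are those opposite to `c` and `d`, and every glued face contains both; this makes `Q`
  -- pass to neighbours.
  have hQ : ∀ i k l, B.label i k c → B.label i l d → k ≠ l ∧ bd i = {k, l} := by
    intro i k l hk hl
    have hkl : k ≠ l := by
      rintro rfl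
      exact hcd (B.unique _ _ _ _ hk hl)
    refine ⟨hkl, Finset.eq_of_subset_of_card_le (fun f hf => ?_) ?_⟩
    · rw [Finset.mem_insert, Finset.mem_singleton]
      by_contra hno
      push Not at hno
      exact hnadj (B.adj (mem_bd.1 hf) hno.1.symm hno.2.symm hkl hk hl)
    · rw [hbd2 i]
      exact Finset.card_le_two
  have hall : ∀ i, Q i := by
    refine hG.forall_of_exists ?_ (i := ⟨0, hm0⟩) ⟨f, g, hc, hd⟩
    rintro i j f' p hgl ⟨k, l, hk, hl⟩
    obtain ⟨-, hb⟩ := hQ i k l hk hl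
    have hne : ∀ k ∈ bd i, k ≠ f' := by
      rintro k hk rfl
      rw [mem_bd.1 hk] at hgl
      cases hgl
    exact ⟨p k, p l, B.glue _ _ _ _ _ _ hgl (hne k (by rw [hb]; simp)) hk,
      B.glue _ _ _ _ _ _ hgl (hne l (by rw [hb]; simp)) hl⟩
  obtain ⟨b, t, ht, hct, hdt⟩ := hhit c d
  obtain ⟨i, f', hf', -, rfl⟩ := B.exists_face b t ht
  obtain ⟨k, l, hk, hl⟩ := hall i
  obtain ⟨hkl, hb⟩ := hQ i k l hk hl
  have hmem : f' ∈ bd i := mem_bd.2 hf'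
  rw [hb, Finset.mem_insert, Finset.mem_singleton] at hmem
  rcases hmem with rfl | rfl
  · obtain ⟨y, hy, hly⟩ := B.labelled i f' l hf' hkl.symm
    exact hdt (B.unique _ _ _ _ hl hly ▸ hy)
  · obtain ⟨y, hy, hly⟩ := B.labelled i f' k hf' hkl
    exact hct (B.unique _ _ _ _ hk hly ▸ hy)

end TetGluing

/-! ### The triangles and the graph of the sphere. -/

theorem triPlus_isEdge_iff {n : ℕ} {a b : Fin (2 * n + 4)} (h : a < b) :
    (triPlus n).IsEdge s(a, b) ↔ b.val = a.val + 1 ∨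
      (a.val = 0 ∧ n + 2 ≤ b.val) ∨ (a.val ≤ n ∧ b.val = n + 2) := by
  have := b.isLt
  rw [IsEdge, mem_triPlus_diagonals h, isSide_iff a b h]
  omega

theorem triMinus_isEdge_iff {n : ℕ} {a b : Fin (2 * n + 4)} (h : a < b) :
    (triMinus n).IsEdge s(a, b) ↔ b.val = a.val + 1 ∨
      (a.val = n + 1 ∧ n + 2 ≤ b.val) ∨ (a.val ≤ n ∧ b.val = 2 * n + 3) := by
  have := b.isLt
  rw [IsEdge, mem_triMinus_diagonals h, isSide_iff a b h]
  omega

theorem Finset.exists_lt_lt_of_card_eq_three {α : Type*} [LinearOrder α] {t : Finset α}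
    (h : t.card = 3) : ∃ a b c, a < b ∧ b < c ∧ t = {a, b, c} := by
  let f := t.orderEmbOfFin h
  refine ⟨f 0, f 1, f 2, f.strictMono (by decide), f.strictMono (by decide), ?_⟩
  ext x
  have : x ∈ Set.range f ↔ x ∈ t := by rw [Finset.range_orderEmbOfFin]; rfl
  rw [← this]
  simp only [Set.mem_range, Finset.mem_insert, Finset.mem_singleton]
  constructor
  · rintro ⟨i, rfl⟩
    fin_cases i <;> simp
  · rintro (rfl | rfl | rfl)
    exacts [⟨0, rfl⟩, ⟨1, rfl⟩, ⟨2, rfl⟩]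

theorem PolygonTriangulation.isTriangle_iff {N : ℕ} (T : PolygonTriangulation N) {a b c : Fin N}
    (hab : a < b) (hbc : b < c) :
    T.IsTriangle {a, b, c} ↔ T.IsEdge s(a, b) ∧ T.IsEdge s(b, c) ∧ T.IsEdge s(a, c) := by
  constructor
  · rintro ⟨-, h⟩
    exact ⟨h a (by simp) b (by simp) hab.ne, h b (by simp) c (by simp) hbc.ne,
      h a (by simp) c (by simp) (hab.trans hbc).ne⟩
  · rintro ⟨h1, h2, h3⟩
    refine ⟨Finset.card_eq_three.2 ⟨a, b, c, hab.ne, (hab.trans hbc).ne, hbc.ne, rfl⟩, ?_⟩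
    intro i hi j hj hij
    simp only [Finset.mem_insert, Finset.mem_singleton] at hi hj
    rcases hi with rfl | rfl | rfl <;> rcases hj with rfl | rfl | rfl <;>
      first
      | exact absurd rfl hij
      | assumption
      | (rw [Sym2.eq_swap]; assumption)

theorem triPlus_isTriangle_iff {n : ℕ} {a b c : Fin (2 * n + 4)} (hab : a < b) (hbc : b < c) :
    (triPlus n).IsTriangle {a, b, c} ↔
      (a.val = 0 ∧ n + 2 ≤ b.val ∧ c.val = b.val + 1) ∨
      (a.val ≤ n ∧ b.val = a.val + 1 ∧ c.val = n + 2) := by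
  rw [isTriangle_iff _ hab hbc, triPlus_isEdge_iff hab, triPlus_isEdge_iff hbc,
    triPlus_isEdge_iff (hab.trans hbc)]
  rw [Fin.lt_def] at hab hbc
  omega

theorem triMinus_isTriangle_iff {n : ℕ} {a b c : Fin (2 * n + 4)} (hab : a < b) (hbc : b < c) :
    (triMinus n).IsTriangle {a, b, c} ↔
      (a.val = n + 1 ∧ c.val = b.val + 1) ∨
      (a.val ≤ n ∧ b.val = a.val + 1 ∧ c.val = 2 * n + 3) := by
  rw [isTriangle_iff _ hab hbc, triMinus_isEdge_iff hab, triMinus_isEdge_iff hbc,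
    triMinus_isEdge_iff (hab.trans hbc)]
  rw [Fin.lt_def] at hab hbc
  omega

theorem not_isTriangle_triPlus_triMinus (n : ℕ) (t : Finset (Fin (2 * n + 4)))
    (h : (triPlus n).IsTriangle t) : ¬ (triMinus n).IsTriangle t := by
  obtain ⟨a, b, c, hab, hbc, rfl⟩ := Finset.exists_lt_lt_of_card_eq_three h.1
  rw [triPlus_isTriangle_iff hab hbc] at h
  rw [triMinus_isTriangle_iff hab hbc]
  rw [Fin.lt_def] at hab hbc
  omega

/-- Sorting the four vertices by number turns this into arithmetic; the two edges from the smallest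
vertex to the two largest already leave few enough cases to check. -/
theorem not_pairwise_sphereAdj {n : ℕ} (hn : 1 ≤ n) (v : Fin 4 → Fin (2 * n + 4)) :
    ¬ ∀ k l, k ≠ l → TetGluing.SphereAdj (triPlus n) (triMinus n) (v k) (v l) := by
  intro h
  have hinj : Function.Injective v := fun k l hkl => by
    by_contra hne
    exact (h k l hne).1 hkl
  have hc : (Finset.univ.image v).card = 4 := by
    rw [Finset.card_image_of_injective _ hinj]
    rfl
  let f := (Finset.univ.image v).orderEmbOfFin hc
  have hadj : ∀ k l, k < l → (triPlus n).IsEdge s(f k, f l) ∨ (triMinus n).IsEdge s(f k, f l) := by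
    intro k l hkl
    obtain ⟨k', -, hk'⟩ := Finset.mem_image.1 (Finset.orderEmbOfFin_mem _ hc k)
    obtain ⟨l', -, hl'⟩ := Finset.mem_image.1 (Finset.orderEmbOfFin_mem _ hc l)
    have hlt : f k < f l := f.strictMono hkl
    have hne : k' ≠ l' := by
      rintro rfl
      exact hlt.ne (hk'.symm.trans hl')
    have := (h k' l' hne).2
    rwa [hk', hl'] at this
  have l01 : f 0 < f 1 := f.strictMono (by decide)
  have l12 : f 1 < f 2 := f.strictMono (by decide)
  have l23 : f 2 < f 3 := f.strictMono (by decide)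
  have e01 := hadj 0 1 (by decide)
  have e02 := hadj 0 2 (by decide)
  have e03 := hadj 0 3 (by decide)
  have e12 := hadj 1 2 (by decide)
  have e13 := hadj 1 3 (by decide)
  have e23 := hadj 2 3 (by decide)
  have b3 := (f 3).isLt
  rw [triPlus_isEdge_iff (by order), triMinus_isEdge_iff (by order)] at e01 e02 e03 e12 e13 e23
  rw [Fin.lt_def] at l01 l12 l23
  generalize (f 0).val = x at *
  generalize (f 1).val = y at *
  generalize (f 2).val = z at *
  generalize (f 3).val = u at *
  clear hadj h
  rcases e03 with (h | h | h) | h | h | h <;> rcases e02 with (h' | h' | h') | h' | h' | h' <;>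
    omega

/-- For $n=1$ this fails, since every triangle contains $u_1$ or $v_1$. For $n\ge2$ twelve
triangles, near the ends of the two paths, already rule out every pair. -/
theorem exists_isTriangle_not_mem {n : ℕ} (hn : 2 ≤ n) (c d : Fin (2 * n + 4)) :
    ∃ b t, (cond b (triPlus n) (triMinus n)).IsTriangle t ∧ c ∉ t ∧ d ∉ t := by
  by_contra hno
  push Not at hno
  have hp : ∀ x y z : ℕ, x < y → y < z → z < 2 * n + 4 →
      (x = 0 ∧ n + 2 ≤ y ∧ z = y + 1) ∨ (x ≤ n ∧ y = x + 1 ∧ z = n + 2) ∨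
      (x = n + 1 ∧ z = y + 1) ∨ (x ≤ n ∧ y = x + 1 ∧ z = 2 * n + 3) →
      (c.val = x ∨ c.val = y ∨ c.val = z) ∨ (d.val = x ∨ d.val = y ∨ d.val = z) := by
    intro x y z hxy hyz hz h
    have g1 : (⟨x, by omega⟩ : Fin (2 * n + 4)) < ⟨y, by omega⟩ := hxy
    have g2 : (⟨y, by omega⟩ : Fin (2 * n + 4)) < ⟨z, by omega⟩ := hyz
    have hor : c ∈ ({⟨x, by omega⟩, ⟨y, by omega⟩, ⟨z, by omega⟩} : Finset (Fin (2 * n + 4))) ∨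
        d ∈ ({⟨x, by omega⟩, ⟨y, by omega⟩, ⟨z, by omega⟩} : Finset (Fin (2 * n + 4))) := by
      by_contra hcd
      push Not at hcd
      rcases or_assoc.2 h with h | h
      · exact hcd.2 (hno true _ ((triPlus_isTriangle_iff g1 g2).2 h) hcd.1)
      · exact hcd.2 (hno false _ ((triMinus_isTriangle_iff g1 g2).2 h) hcd.1)
    simpa [Fin.ext_iff] using hor
  have h1 := hp 0 (n + 2) (n + 3) (by omega) (by omega) (by omega) (by omega)
  have h2 := hp 0 (2 * n + 2) (2 * n + 3) (by omega) (by omega) (by omega) (by omega)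
  have h3 := hp (n + 1) (n + 2) (n + 3) (by omega) (by omega) (by omega) (by omega)
  have h4 := hp (n + 1) (2 * n + 2) (2 * n + 3) (by omega) (by omega) (by omega) (by omega)
  have h5 := hp 0 1 (n + 2) (by omega) (by omega) (by omega) (by omega)
  have h6 := hp n (n + 1) (n + 2) (by omega) (by omega) (by omega) (by omega)
  have h7 := hp 0 1 (2 * n + 3) (by omega) (by omega) (by omega) (by omega)
  have h8 := hp n (n + 1) (2 * n + 3) (by omega) (by omega) (by omega) (by omega)
  have h9 := hp 1 2 (n + 2) (by omega) (by omega) (by omega) (by omega)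
  have h10 := hp 1 2 (2 * n + 3) (by omega) (by omega) (by omega) (by omega)
  have h11 := hp 0 (n + 3) (n + 4) (by omega) (by omega) (by omega) (by omega)
  have h12 := hp (n + 1) (n + 3) (n + 4) (by omega) (by omega) (by omega) (by omega)
  clear hp hno
  -- The triangles $BCu_n$ and $v_nAD$ are disjoint, so one of `c`, `d` lies in the first and the
  -- other in the second. Each such pair misses one of the remaining triangles.
  rcases h1 with (h1 | h1 | h1) | h1 | h1 | h1 <;> rcases h8 with (h8 | h8 | h8) | h8 | h8 | h8 <;>
    omega

/-- The triangles of the sphere `τₙ`. -/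
def sphereTriangle (n : ℕ) (x : Bool × Bool × Fin (n + 1)) : Finset (Fin (2 * n + 4)) :=
  bif x.2.1 then
    {⟨if x.1 then 0 else n + 1, by split_ifs <;> omega⟩, ⟨n + 2 + x.2.2.val, by omega⟩,
      ⟨n + 3 + x.2.2.val, by omega⟩}
  else
    {⟨x.2.2.val, by omega⟩, ⟨x.2.2.val + 1, by omega⟩,
      ⟨if x.1 then n + 2 else 2 * n + 3, by split_ifs <;> omega⟩}

theorem sphereTriangle_isTriangle (n : ℕ) (x : Bool × Bool × Fin (n + 1)) :
    (cond x.1 (triPlus n) (triMinus n)).IsTriangle (sphereTriangle n x) := by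
  obtain ⟨b, b', i⟩ := x
  have hi := i.isLt
  cases b <;> cases b' <;> simp only [sphereTriangle, cond_true, cond_false, if_true,
    Bool.false_eq_true, if_false]
  · refine (triMinus_isTriangle_iff ?_ ?_).2 ?_ <;>
      simp only [Fin.lt_def, and_true] <;> omega
  · refine (triMinus_isTriangle_iff ?_ ?_).2 ?_ <;>
      simp only [Fin.lt_def, true_and] <;> omega
  · refine (triPlus_isTriangle_iff ?_ ?_).2 ?_ <;>
      simp only [Fin.lt_def, and_true] <;> omega
  · refine (triPlus_isTriangle_iff ?_ ?_).2 ?_ <;>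
      simp only [Fin.lt_def, true_and] <;> omega

theorem sphereTriangle_injective (n : ℕ) :
    Function.Injective fun x => (x.1, sphereTriangle n x) := by
  rintro ⟨b, c, i⟩ ⟨b', c', j⟩ h
  simp only [Prod.mk.injEq] at h
  obtain ⟨rfl, h⟩ := h
  have key : ∀ v : Fin (2 * n + 4),
      v ∈ sphereTriangle n (b, c, i) → v ∈ sphereTriangle n (b, c', j) :=
    fun v hv => h ▸ hv
  have hi := i.isLt
  have hj := j.isLt
  cases c <;> cases c' <;> simp only [sphereTriangle, cond_true, cond_false] at key h
  · have h1 := key ⟨i.val, by omega⟩ (by simp)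
    have h2 := key ⟨i.val + 1, by omega⟩ (by simp)
    simp only [Finset.mem_insert, Finset.mem_singleton, Fin.ext_iff] at h1 h2
    have : i = j := by
      ext
      cases b <;> simp at h1 h2 <;> omega
    rw [this]
  · have h1 := key ⟨i.val, by omega⟩ (by simp)
    have h2 := key ⟨i.val + 1, by omega⟩ (by simp)
    simp only [Finset.mem_insert, Finset.mem_singleton, Fin.ext_iff] at h1 h2
    exfalso
    cases b <;> simp at h1 h2 <;> omega
  · have h1 := key ⟨n + 2 + i.val, by omega⟩ (by simp)
    have h2 := key ⟨n + 3 + i.val, by omega⟩ (by simp)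
    simp only [Finset.mem_insert, Finset.mem_singleton, Fin.ext_iff] at h1 h2
    exfalso
    cases b <;> simp at h1 h2 <;> omega
  · have h1 := key ⟨n + 2 + i.val, by omega⟩ (by simp)
    have h2 := key ⟨n + 3 + i.val, by omega⟩ (by simp)
    simp only [Finset.mem_insert, Finset.mem_singleton, Fin.ext_iff] at h1 h2
    have : i = j := by
      ext
      cases b <;> simp at h1 h2 <;> omega
    rw [this]

/-- There are $2\cdot2\cdot(n+1)=2(2n+2)$ triangles, so the counting bound applies with $M=2n+2$ and
its inequality is strict. -/
theorem le_of_isBall_of_extends {n m : ℕ} (hn : 2 ≤ n) {G : TetGluing m} (hG : G.IsBall)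
    (hE : G.Extends (triPlus n) (triMinus n)) : 2 * n + 3 ≤ m := by
  classical
  refine TetGluing.lt_of_isBall_of_extends (M := 2 * n + 2) (not_isTriangle_triPlus_triMinus n)
    (not_pairwise_sphereAdj (by omega)) (exists_isTriangle_not_mem hn)
    (Finset.univ.image fun x => (x.1, sphereTriangle n x)) ?_ (by omega) ?_ hG hE
  · intro x hx
    obtain ⟨y, -, rfl⟩ := Finset.mem_image.1 hx
    exact sphereTriangle_isTriangle n y
  · rw [Finset.card_image_of_injective _ (sphereTriangle_injective n), Finset.card_univ]
    simp only [Fintype.card_prod, Fintype.card_bool, Fintype.card_fin]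
    omega

/-! ### Recognising a ball with prescribed boundary from labels and positions. -/

namespace TetGluing

variable {m N : ℕ} {G : TetGluing m} {T T' : PolygonTriangulation N}

/-- The affine extension to a tetrahedron of a function `g` on the labels of its vertices. -/
def labelSum (L : Fin m → Fin 4 → Fin N) (g : Fin N → ℝ) (a : Fin m × stdSimplex ℝ (Fin 4)) : ℝ :=
  ∑ k, a.2.1 k * g (L a.1 k)

/-- The gluing maps preserve the labels of the vertices. -/
def Compatible (G : TetGluing m) (L : Fin m → Fin 4 → Fin N) : Prop :=
  ∀ i f j p, G.glue i f = some (j, p) → ∀ k, k ≠ f → L j (p k) = L i k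

/-- The labels of corresponding vertices agree except opposite to the glued face, where the
barycentric coordinate vanishes. -/
theorem Compatible.labelSum_eq {L : Fin m → Fin 4 → Fin N} (hL : G.Compatible L) (g : Fin N → ℝ)
    {a b : Fin m × stdSimplex ℝ (Fin 4)} (h : G.Rel a b) : labelSum L g a = labelSum L g b := by
  obtain ⟨f, p, hg, h0, hp⟩ := h
  rw [labelSum, labelSum, ← Equiv.sum_comp p (fun k => b.2.1 k * g (L b.1 k))]
  refine Finset.sum_congr rfl fun k _ => ?_
  rw [hp k]
  by_cases hk : k = f
  · rw [hk, h0, zero_mul, zero_mul]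
  · rw [hL _ _ _ _ hg k hk]

theorem Compatible.labelSum_eq_of_mk_eq {L : Fin m → Fin 4 → Fin N} (hL : G.Compatible L)
    (g : Fin N → ℝ) {a b : Fin m × stdSimplex ℝ (Fin 4)}
    (h : Quot.mk G.Rel a = Quot.mk G.Rel b) : labelSum L g a = labelSum L g b :=
  congrArg (Quot.lift (labelSum L g) fun _ _ => hL.labelSum_eq g) h

theorem exists_rel {i j : Fin m} {f : Fin 4} {p : Equiv.Perm (Fin 4)}
    (hg : G.glue i f = some (j, p)) {x : stdSimplex ℝ (Fin 4)} (hx : x.1 f = 0) :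
    ∃ y, G.Rel (i, x) (j, y) :=
  ⟨⟨fun k => x.1 (p.symm k), fun k => x.2.1 _, (Equiv.sum_comp p.symm x.1).trans x.2.2⟩, f, p, hg,
    hx, fun k => by simp⟩

/-- The barycentric coordinate of a point with respect to the label `v`. -/
def labelWeight (L : Fin m → Fin 4 → Fin N) (a : Fin m × stdSimplex ℝ (Fin 4)) (v : Fin N) : ℝ :=
  labelSum L (Pi.single v 1) a

theorem labelSum_eq_sum_labelWeight (L : Fin m → Fin 4 → Fin N) (g : Fin N → ℝ)
    (a : Fin m × stdSimplex ℝ (Fin 4)) : labelSum L g a = ∑ v, labelWeight L a v * g v := by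
  simp only [labelWeight, labelSum, Finset.sum_mul]
  rw [Finset.sum_comm]
  refine Finset.sum_congr rfl fun k _ => ?_
  simp [Pi.single_apply]

theorem labelWeight_eq {L : Fin m → Fin 4 → Fin N} {i : Fin m} (hL : Function.Injective (L i))
    {x : stdSimplex ℝ (Fin 4)} {w : Fin N → ℝ} (hx : ∀ k, x.1 k = w (L i k))
    (hw : ∀ v, v ∉ Set.range (L i) → w v = 0) : labelWeight L (i, x) = w := by
  funext v
  simp only [labelWeight, labelSum, Pi.single_apply, mul_ite, mul_one, mul_zero]
  by_cases hv : v ∈ Set.range (L i)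
  · obtain ⟨k, rfl⟩ := hv
    simp [hL.eq_iff, hx]
  · rw [hw v hv]
    refine Finset.sum_eq_zero fun k _ => if_neg fun h => hv ⟨k, h⟩

/-- Points of the tetrahedra with equal labelled barycentric coordinates are glued. -/
def Separated (G : TetGluing m) (L : Fin m → Fin 4 → Fin N) : Prop :=
  ∀ a b, labelWeight L a = labelWeight L b → Quot.mk G.Rel a = Quot.mk G.Rel b

/-- The embedding sends a point of the sphere to the point of the gluing with the same weights on
the labels; `Separated` makes it independent of the tetrahedron used, and `Compatible` makes the
weights recoverable from the image. Injectivity then needs only that points of different discs with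
equal weights lie on the rim, which is `hrim`. -/
theorem extends_of_labels {L : Fin m → Fin 4 → Fin N} (hL : ∀ i, Function.Injective (L i))
    (hc : G.Compatible L) (hs : G.Separated L)
    (h1 : ∀ b t, (cond b T T').IsTriangle t →
      ∃ i f, G.glue i f = none ∧ Set.BijOn (L i) {k | k ≠ f} {v | v ∈ t})
    (h2 : ∀ i f, G.glue i f = none →
      ∃ b t, (cond b T T').IsTriangle t ∧ Set.BijOn (L i) {k | k ≠ f} {v | v ∈ t})
    (hrim : ∀ t t', T.IsTriangle t → T'.IsTriangle t' →
      ∃ i j, IsSide s(i, j) ∧ ∀ k ∈ t, k ∈ t' → k = i ∨ k = j) :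
    G.Extends T T' := by
  have hex : ∀ z : GluedSphere T T', ∃ a, labelWeight L a = z.weight := by
    have : ∀ b (w : (cond b T T').disc), ∃ a, labelWeight L a = w.1 := by
      rintro b ⟨w, hw, t, ht, hwt⟩
      obtain ⟨i, f, -, hb⟩ := h1 b t ht
      have hout : ∀ v, v ∉ Set.range (L i) → w v = 0 := fun v hv => hwt v fun hvt => by
        obtain ⟨k, -, rfl⟩ := hb.surjOn hvt
        exact hv ⟨k, rfl⟩
      refine ⟨(i, ⟨fun k => w (L i k), fun k => hw.1 _, ?_⟩), labelWeight_eq (hL i)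
        (fun k => rfl) hout⟩
      rw [← hw.2, ← Finset.sum_image (f := w) (g := L i) fun a _ b _ h => hL i h]
      refine Finset.sum_subset (Finset.subset_univ _) fun v _ hv => hout v ?_
      rintro ⟨k, rfl⟩
      exact hv (Finset.mem_image_of_mem _ (Finset.mem_univ k))
    refine Quot.ind ?_
    rintro (w | w)
    · exact this true w
    · exact this false w
  choose a ha using hex
  let Φ : GluedSphere T T' → G.Space := fun z => Quot.mk G.Rel (a z)
  have hΦ : ∀ z c, labelWeight L c = z.weight → Φ z = Quot.mk G.Rel c := fun z c h =>
    hs _ _ ((ha z).trans h.symm)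
  have hface : ∀ b t i f, Set.BijOn (L i) {k | k ≠ f} {v | v ∈ t} →
      G.IsFaceMap (T := cond b T T') (fun w => Φ (GluedSphere.incl T T' b w)) t i f := by
    intro b t i f hb
    refine ⟨L i, hb, fun w x hw hx0 hx => hΦ _ _ ?_⟩
    rw [GluedSphere.weight_incl]
    have hmem : ∀ k, L i k ∈ t → k ≠ f := fun k hk hkf => by
      obtain ⟨l, hl, hlk⟩ := hb.surjOn hk
      exact hl ((hL i hlk).trans hkf)
    refine labelWeight_eq (hL i) (fun k => ?_) fun v hv => hw v fun hvt => ?_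
    · by_cases hk : k = f
      · rw [hk, hx0, hw]
        exact fun h => hmem f h rfl
      · exact hx k hk
    · obtain ⟨k, -, rfl⟩ := hb.surjOn hvt
      exact hv ⟨k, rfl⟩
  have key : ∀ (w : T.disc) (w' : T'.disc), w.1 = w'.1 → rimRel T T' (Sum.inl w) (Sum.inr w') := by
    rintro ⟨w, hw, t, ht, hwt⟩ ⟨w', hw', t', ht', hwt'⟩ h
    simp only at h
    subst h
    obtain ⟨i, j, hij, h⟩ := hrim t t' ht ht'
    refine ⟨rfl, i, j, hij, fun k hki hkj => ?_⟩
    by_cases hk : k ∈ t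
    · exact hwt' k fun hk' => (h k hk hk').elim hki hkj
    · exact hwt k hk
  refine ⟨Φ, ?_, fun t ht => ?_, fun t ht => ?_, fun i f hf => ?_⟩
  · intro z z' h
    have hw : z.weight = z'.weight := by
      rw [← ha z, ← ha z']
      exact funext fun v => hc.labelSum_eq_of_mk_eq _ h
    clear h
    obtain ⟨w, rfl⟩ := Quot.exists_rep z
    obtain ⟨w', rfl⟩ := Quot.exists_rep z'
    rcases w with w | w <;> rcases w' with w' | w'
    · rw [show w = w' from Subtype.ext hw]
    · exact Quot.sound (key w w' hw)
    · exact (Quot.sound (key w' w hw.symm)).symm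
    · rw [show w = w' from Subtype.ext hw]
  · obtain ⟨i, f, hf, hb⟩ := h1 true t ht
    exact ⟨i, f, hf, hface true t i f hb⟩
  · obtain ⟨i, f, hf, hb⟩ := h1 false t ht
    exact ⟨i, f, hf, hface false t i f hb⟩
  · obtain ⟨b, t, ht, hb⟩ := h2 i f hf
    cases b
    · exact Or.inr ⟨t, ht, hface false t i f hb⟩
    · exact Or.inl ⟨t, ht, hface true t i f hb⟩

/-- The map to Euclidean space that is affine on each tetrahedron and takes the values `g` at
the vertices. -/
noncomputable def labelMap (L : Fin m → Fin 4 → Fin N) (g : Fin 3 → Fin N → ℝ)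
    (a : Fin m × stdSimplex ℝ (Fin 4)) : EuclideanSpace ℝ (Fin 3) :=
  WithLp.toLp 2 fun c => labelSum L (g c) a

theorem continuous_labelMap (L : Fin m → Fin 4 → Fin N) (g : Fin 3 → Fin N → ℝ) :
    Continuous (labelMap L g) := by
  refine (PiLp.continuous_toLp 2 _).comp
    (continuous_pi fun c => continuous_finsetSum _ fun k _ => ?_)
  refine Continuous.mul ?_ ?_
  · exact (continuous_apply k).comp (continuous_subtype_val.comp continuous_snd)
  · exact (continuous_of_discreteTopology (f := fun i => g c (L i k))).comp continuous_fst

/-- The positions induce a continuous bijection from the compact glued space onto a compact convex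
set with interior points, hence a homeomorphism; such a set is homeomorphic to the ball. -/
theorem isBall_of_labelMap {L : Fin m → Fin 4 → Fin N} (hc : G.Compatible L)
    (g : Fin 3 → Fin N → ℝ)
    (hinj : ∀ a b, labelMap L g a = labelMap L g b → Quot.mk G.Rel a = Quot.mk G.Rel b)
    (hconv : Convex ℝ (Set.range (labelMap L g)))
    (hint : (interior (Set.range (labelMap L g))).Nonempty) : G.IsBall := by
  set K := Set.range (labelMap L g) with hK
  have hcomp : IsCompact K := isCompact_range (continuous_labelMap L g)
  obtain ⟨h, -, hcl, -⟩ :=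
    exists_homeomorph_image_interior_closure_frontier_eq_unitBall hconv hint hcomp.isBounded
  rw [hcomp.isClosed.closure_eq] at hcl
  have : CompactSpace G.Space := inferInstanceAs (CompactSpace (Quot G.Rel))
  have hrel : ∀ a b, G.Rel a b → (⟨labelMap L g a, a, rfl⟩ : K) = ⟨labelMap L g b, b, rfl⟩ := by
    intro a b hab
    refine Subtype.ext ?_
    simp only [labelMap]
    congr 1
    exact funext fun c => hc.labelSum_eq _ hab
  let φ : G.Space → K := Quot.lift (fun a => ⟨labelMap L g a, a, rfl⟩) hrel
  have hφ : Continuous φ := continuous_quot_lift _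
    ((continuous_labelMap L g).subtype_mk _)
  have hbij : Function.Bijective φ := by
    constructor
    · intro z z' hab
      obtain ⟨a, rfl⟩ := Quot.exists_rep z
      obtain ⟨b, rfl⟩ := Quot.exists_rep z'
      exact hinj a b (congrArg Subtype.val hab)
    · rintro ⟨_, a, rfl⟩
      exact ⟨Quot.mk _ a, rfl⟩
  let e : G.Space ≃ₜ K := Continuous.homeoOfEquivCompactToT2 (f := Equiv.ofBijective φ hbij) hφ
  exact ⟨e.trans ((h.image K).trans (Homeomorph.setCongr hcl))⟩

/-- The position of a point depends only on its label weights, so equal weights give equal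
positions. -/
theorem separated_of_labelMap {L : Fin m → Fin 4 → Fin N}
    (g : Fin 3 → Fin N → ℝ)
    (hinj : ∀ a b, labelMap L g a = labelMap L g b → Quot.mk G.Rel a = Quot.mk G.Rel b) :
    G.Separated L := by
  intro a b h
  refine hinj a b ?_
  simp only [labelMap, labelSum_eq_sum_labelWeight, h]

end TetGluing

/-! ### The gluing of $2n+3$ tetrahedra. -/

/-- The bijection from the vertices of `ABCD` to those of a tetrahedron of the second fan, or back,
that sends `A` and `B` to the path and `C` and `D` to the axis. -/
def bridgePerm : Equiv.Perm (Fin 4) := Equiv.swap 0 2 * Equiv.swap 1 3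

/-- The face `f` of the tetrahedron `i` is glued to the tetrahedron `j` by `p`. The tetrahedra
`0, ..., n` form a fan around `AB`, the tetrahedron `n + 1` is `ABCD`, and the remaining ones form
a fan around `CD`. -/
def FanGlueRel (n i : ℕ) (f : Fin 4) (j : ℕ) (p : Equiv.Perm (Fin 4)) : Prop :=
  (p = Equiv.swap 2 3 ∧ ((f.val = 2 ∧ j = i + 1 ∧ (i < n ∨ n + 2 ≤ i)) ∨
    (f.val = 3 ∧ i = j + 1 ∧ (j < n ∨ n + 2 ≤ j)))) ∨
  (p = 1 ∧ ((f.val = 2 ∧ (i = n ∧ j = n + 1 ∨ i = n + 1 ∧ j = n)) ∨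
    (f.val = 3 ∧ (i = 0 ∧ j = n + 1 ∨ i = n + 1 ∧ j = 0)))) ∨
  (p = bridgePerm ∧ ((f.val = 0 ∧ i = n + 1 ∧ j = 2 * n + 2) ∨
    (f.val = 2 ∧ i = 2 * n + 2 ∧ j = n + 1) ∨ (f.val = 1 ∧ i = n + 1 ∧ j = n + 2) ∨
    (f.val = 3 ∧ i = n + 2 ∧ j = n + 1)))

/-- The range bounds matter: at the last tetrahedron of the second fan the first clause would lead
to the index $2n+3$, which does not exist, and only the bridge to $ABCD$ remains. -/
theorem FanGlueRel.unique {n i j j' : ℕ} {f : Fin 4} {p p' : Equiv.Perm (Fin 4)}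
    (hj : j < 2 * n + 3) (hj' : j' < 2 * n + 3)
    (h : FanGlueRel n i f j p) (h' : FanGlueRel n i f j' p') : j = j' ∧ p = p' := by
  rcases h with ⟨rfl, h⟩ | ⟨rfl, h⟩ | ⟨rfl, h⟩ <;>
    rcases h' with ⟨rfl, h'⟩ | ⟨rfl, h'⟩ | ⟨rfl, h'⟩ <;>
    first
    | exact ⟨by omega, rfl⟩
    | (exfalso; omega)

theorem FanGlueRel.symm {n i j : ℕ} {f : Fin 4} {p : Equiv.Perm (Fin 4)}
    (h : FanGlueRel n i f j p) : FanGlueRel n j (p f) i p⁻¹ := by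
  have hb : bridgePerm⁻¹ = bridgePerm := by decide
  have fin : ∀ k : Fin 4, f.val = k.val → f = k := fun k h => Fin.ext h
  rcases h with ⟨rfl, ⟨hf, h⟩ | ⟨hf, h⟩⟩ | ⟨rfl, ⟨hf, h⟩ | ⟨hf, h⟩⟩ |
    ⟨rfl, ⟨hf, h⟩ | ⟨hf, h⟩ | ⟨hf, h⟩ | ⟨hf, h⟩⟩
  · obtain rfl := fin 2 hf
    exact Or.inl ⟨by simp, Or.inr ⟨by decide, by omega⟩⟩
  · obtain rfl := fin 3 hf
    exact Or.inl ⟨by simp, Or.inl ⟨by decide, by omega⟩⟩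
  · exact Or.inr (Or.inl ⟨by simp, Or.inl ⟨hf, by omega⟩⟩)
  · exact Or.inr (Or.inl ⟨by simp, Or.inr ⟨hf, by omega⟩⟩)
  · obtain rfl := fin 0 hf
    exact Or.inr (Or.inr ⟨hb, Or.inr (Or.inl ⟨by decide, by omega⟩)⟩)
  · obtain rfl := fin 2 hf
    exact Or.inr (Or.inr ⟨hb, Or.inl ⟨by decide, by omega⟩⟩)
  · obtain rfl := fin 1 hf
    exact Or.inr (Or.inr ⟨hb, Or.inr (Or.inr (Or.inr ⟨by decide, by omega⟩))⟩)
  · obtain rfl := fin 3 hf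
    exact Or.inr (Or.inr ⟨hb, Or.inr (Or.inr (Or.inl ⟨by decide, by omega⟩))⟩)

open Classical in
/-- The two fans and the tetrahedron `ABCD`, glued. -/
noncomputable def fanGluing (n : ℕ) : TetGluing (2 * n + 3) where
  glue i f := if h : ∃ a : Fin (2 * n + 3) × Equiv.Perm (Fin 4), FanGlueRel n i f a.1 a.2
    then some h.choose else none
  glue_symm := by
    intro i f j p h
    split_ifs at h with h1
    have hs := h1.choose_spec
    rw [Option.some.inj h] at hs
    have hex : ∃ a : Fin (2 * n + 3) × Equiv.Perm (Fin 4), FanGlueRel n j (p f) a.1 a.2 :=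
      ⟨(i, p⁻¹), hs.symm⟩
    rw [dif_pos hex]
    obtain ⟨h2, h3⟩ := FanGlueRel.unique hex.choose.1.isLt i.isLt hex.choose_spec hs.symm
    exact congrArg some (Prod.ext (Fin.ext h2) h3)
  glue_ne := by
    intro i f j p h
    split_ifs at h with h1
    have hs := h1.choose_spec
    rw [Option.some.inj h] at hs
    intro heq
    obtain ⟨rfl, -⟩ := Prod.mk.inj heq
    dsimp only [FanGlueRel] at hs
    omega

theorem fanGluing_glue_eq_some_iff {n : ℕ} {i j : Fin (2 * n + 3)} {f : Fin 4}
    {p : Equiv.Perm (Fin 4)} : (fanGluing n).glue i f = some (j, p) ↔ FanGlueRel n i f j p := by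
  classical
  constructor
  · intro h
    simp only [fanGluing] at h
    split_ifs at h with h1
    have hs := h1.choose_spec
    rwa [Option.some.inj h] at hs
  · intro h
    have hex : ∃ a : Fin (2 * n + 3) × Equiv.Perm (Fin 4), FanGlueRel n i f a.1 a.2 :=
      ⟨(j, p), h⟩
    simp only [fanGluing]
    rw [dif_pos hex]
    obtain ⟨h2, h3⟩ := FanGlueRel.unique hex.choose.1.isLt j.isLt hex.choose_spec h
    exact congrArg some (Prod.ext (Fin.ext h2) h3)

/-- The vertices of the tetrahedra of `fanGluing`, as numbers. -/
def fanLabelNat (n i : ℕ) : Fin 4 → ℕ :=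
  if i ≤ n then ![0, n + 1, n + 2 + i, n + 3 + i]
  else if i = n + 1 then ![0, n + 1, n + 2, 2 * n + 3]
  else ![n + 2, 2 * n + 3, i - (n + 2), i - (n + 1)]

theorem fanLabelNat_first {n i : ℕ} (h : i ≤ n) :
    fanLabelNat n i = ![0, n + 1, n + 2 + i, n + 3 + i] := if_pos h

theorem fanLabelNat_middle (n : ℕ) :
    fanLabelNat n (n + 1) = ![0, n + 1, n + 2, 2 * n + 3] := by
  rw [fanLabelNat, if_neg (by omega), if_pos rfl]

theorem fanLabelNat_second (n j : ℕ) :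
    fanLabelNat n (n + 2 + j) = ![n + 2, 2 * n + 3, j, j + 1] := by
  rw [fanLabelNat, if_neg (by omega), if_neg (by omega)]
  congr 3
  · omega
  · congr 1
    omega

theorem fan_cases {n i : ℕ} (h : i < 2 * n + 3) :
    i ≤ n ∨ i = n + 1 ∨ ∃ j, j ≤ n ∧ i = n + 2 + j := by
  by_cases h1 : i ≤ n
  · exact Or.inl h1
  · by_cases h2 : i = n + 1
    · exact Or.inr (Or.inl h2)
    · exact Or.inr (Or.inr ⟨i - (n + 2), by omega, by omega⟩)

theorem fanLabelNat_lt {n i : ℕ} (h : i < 2 * n + 3) (k : Fin 4) :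
    fanLabelNat n i k < 2 * n + 4 := by
  rcases fan_cases h with h1 | rfl | ⟨j, h1, rfl⟩
  · rw [fanLabelNat_first h1]
    fin_cases k <;> simp <;> omega
  · rw [fanLabelNat_middle]
    fin_cases k <;> simp <;> omega
  · rw [fanLabelNat_second]
    fin_cases k <;> simp <;> omega

/-- The vertices of the tetrahedra of `fanGluing`. -/
def fanLabel (n : ℕ) (i : Fin (2 * n + 3)) (k : Fin 4) : Fin (2 * n + 4) :=
  ⟨fanLabelNat n i k, fanLabelNat_lt i.isLt k⟩

theorem fanLabel_injective {n : ℕ} (hn : 1 ≤ n) (i : Fin (2 * n + 3)) :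
    Function.Injective (fanLabel n i) := by
  intro k l h
  simp only [fanLabel, Fin.ext_iff] at h
  rcases fan_cases i.isLt with h1 | h1 | ⟨j, h1, h2⟩
  · rw [fanLabelNat_first h1] at h
    fin_cases k <;> fin_cases l <;> simp at h ⊢ <;> omega
  · rw [h1, fanLabelNat_middle] at h
    fin_cases k <;> fin_cases l <;> simp at h ⊢ <;> omega
  · rw [h2, fanLabelNat_second] at h
    fin_cases k <;> fin_cases l <;> simp at h ⊢ <;> omega

/-- Consecutive tetrahedra of a fan share the axis and one path vertex, which has number 3 in the
former and number 2 in the latter; hence `swap 2 3`. The two ends of each fan meet $ABCD$, since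
each path joins the ends of the other fan's axis. -/
theorem FanGlueRel.fanLabelNat_eq {n i j : ℕ} {f : Fin 4} {p : Equiv.Perm (Fin 4)}
    (hi : i < 2 * n + 3) (hj : j < 2 * n + 3)
    (h : FanGlueRel n i f j p) (k : Fin 4) (hk : k ≠ f) :
    fanLabelNat n j (p k) = fanLabelNat n i k := by
  have fin : ∀ k : Fin 4, f.val = k.val → f = k := fun k h => Fin.ext h
  have s0 : (Equiv.swap 2 3 : Equiv.Perm (Fin 4)) 0 = 0 := by decide
  have s1 : (Equiv.swap 2 3 : Equiv.Perm (Fin 4)) 1 = 1 := by decide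
  have b0 : bridgePerm 0 = 2 := by decide
  have b1 : bridgePerm 1 = 3 := by decide
  have b2 : bridgePerm 2 = 0 := by decide
  have b3 : bridgePerm 3 = 1 := by decide
  rcases h with ⟨rfl, ⟨hf, h⟩ | ⟨hf, h⟩⟩ | ⟨rfl, ⟨hf, h⟩ | ⟨hf, h⟩⟩ |
    ⟨rfl, ⟨hf, h⟩ | ⟨hf, h⟩ | ⟨hf, h⟩ | ⟨hf, h⟩⟩
  · obtain rfl := fin 2 hf
    obtain ⟨rfl, h | h⟩ := h
    · rw [fanLabelNat_first (show i ≤ n by omega), fanLabelNat_first (show i + 1 ≤ n by omega)]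
      fin_cases k <;> simp [s0, s1] at hk ⊢
      omega
    · obtain ⟨i, rfl⟩ := Nat.exists_eq_add_of_le h
      rw [fanLabelNat_second, add_assoc, fanLabelNat_second]
      fin_cases k <;> simp [s0, s1] at hk ⊢
  · obtain rfl := fin 3 hf
    obtain ⟨rfl, h | h⟩ := h
    · rw [fanLabelNat_first (show j ≤ n by omega), fanLabelNat_first (show j + 1 ≤ n by omega)]
      fin_cases k <;> simp [s0, s1] at hk ⊢
      omega
    · obtain ⟨j, rfl⟩ := Nat.exists_eq_add_of_le h
      rw [fanLabelNat_second, add_assoc, fanLabelNat_second]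
      fin_cases k <;> simp [s0, s1] at hk ⊢
  · obtain rfl := fin 2 hf
    rcases h with ⟨rfl, rfl⟩ | ⟨rfl, rfl⟩
    · rw [fanLabelNat_first le_rfl, fanLabelNat_middle]
      fin_cases k <;> simp at hk ⊢
      omega
    · rw [fanLabelNat_first le_rfl, fanLabelNat_middle]
      fin_cases k <;> simp at hk ⊢
      omega
  · obtain rfl := fin 3 hf
    rcases h with ⟨rfl, rfl⟩ | ⟨rfl, rfl⟩
    · rw [fanLabelNat_first (Nat.zero_le _), fanLabelNat_middle]
      fin_cases k <;> simp at hk ⊢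
    · rw [fanLabelNat_first (Nat.zero_le _), fanLabelNat_middle]
      fin_cases k <;> simp at hk ⊢
  · obtain rfl := fin 0 hf
    obtain ⟨rfl, rfl⟩ := h
    rw [show 2 * n + 2 = n + 2 + n by omega, fanLabelNat_second, fanLabelNat_middle]
    fin_cases k <;> simp [b1, b2, b3] at hk ⊢
  · obtain rfl := fin 2 hf
    obtain ⟨rfl, rfl⟩ := h
    rw [show 2 * n + 2 = n + 2 + n by omega, fanLabelNat_second, fanLabelNat_middle]
    fin_cases k <;> simp [b0, b1, b3] at hk ⊢
  · obtain rfl := fin 1 hf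
    obtain ⟨rfl, rfl⟩ := h
    rw [show n + 2 = n + 2 + 0 by omega, fanLabelNat_second, fanLabelNat_middle]
    fin_cases k <;> simp [b0, b2, b3] at hk ⊢
  · obtain rfl := fin 3 hf
    obtain ⟨rfl, rfl⟩ := h
    rw [show n + 2 = n + 2 + 0 by omega, fanLabelNat_second, fanLabelNat_middle]
    fin_cases k <;> simp [b0, b1, b2] at hk ⊢

theorem fanGluing_compatible (n : ℕ) : (fanGluing n).Compatible (fanLabel n) := by
  intro i f j p h k hk
  exact Fin.ext ((fanGluing_glue_eq_some_iff.1 h).fanLabelNat_eq i.isLt j.isLt k hk)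

/-- The tetrahedra around an axis close up with $ABCD$ to a full cycle, so only the faces opposite
to the two ends of the axis stay free: two for each tetrahedron of a fan, none for $ABCD$. -/
theorem fanGluing_glue_eq_none_iff {n : ℕ} {i : Fin (2 * n + 3)} {f : Fin 4} :
    (fanGluing n).glue i f = none ↔ i.val ≠ n + 1 ∧ f.val ≤ 1 := by
  have hi := i.isLt
  have hf := f.isLt
  constructor
  · intro h
    have hno : ∀ j p, j < 2 * n + 3 → ¬ FanGlueRel n i f j p := by
      intro j p hj hr
      have h1 : (fanGluing n).glue i f = some (⟨j, hj⟩, p) := fanGluing_glue_eq_some_iff.2 hr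
      rw [h1] at h
      cases h
    have h1 : ∀ j, ¬ (j < 2 * n + 3 ∧ ((f.val = 2 ∧ j = i.val + 1 ∧ (i.val < n ∨ n + 2 ≤ i.val)) ∨
        (f.val = 3 ∧ i.val = j + 1 ∧ (j < n ∨ n + 2 ≤ j)))) :=
      fun j h => hno j _ h.1 (Or.inl ⟨rfl, h.2⟩)
    have h2 : ∀ j, ¬ (j < 2 * n + 3 ∧
        ((f.val = 2 ∧ (i.val = n ∧ j = n + 1 ∨ i.val = n + 1 ∧ j = n)) ∨
        (f.val = 3 ∧ (i.val = 0 ∧ j = n + 1 ∨ i.val = n + 1 ∧ j = 0)))) :=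
      fun j h => hno j _ h.1 (Or.inr (Or.inl ⟨rfl, h.2⟩))
    have h3 : ∀ j, ¬ (j < 2 * n + 3 ∧ ((f.val = 0 ∧ i.val = n + 1 ∧ j = 2 * n + 2) ∨
        (f.val = 2 ∧ i.val = 2 * n + 2 ∧ j = n + 1) ∨ (f.val = 1 ∧ i.val = n + 1 ∧ j = n + 2) ∨
        (f.val = 3 ∧ i.val = n + 2 ∧ j = n + 1))) :=
      fun j h => hno j _ h.1 (Or.inr (Or.inr ⟨rfl, h.2⟩))
    by_contra hcon
    have hcon : i.val = n + 1 ∨ f.val = 2 ∨ f.val = 3 := by omega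
    by_cases c1 : i.val = n + 1
    · have hf' : f.val = 0 ∨ f.val = 1 ∨ f.val = 2 ∨ f.val = 3 := by omega
      rcases hf' with h | h | h | h
      · exact h3 (2 * n + 2) (by omega)
      · exact h3 (n + 2) (by omega)
      · exact h2 n (by omega)
      · exact h2 0 (by omega)
    rcases hcon.resolve_left c1 with c2 | c2
    · by_cases c3 : i.val = n
      · exact h2 (n + 1) (by omega)
      by_cases c4 : i.val = 2 * n + 2
      · exact h3 (n + 1) (by omega)
      exact h1 (i.val + 1) (by omega)
    · by_cases c3 : i.val = 0
      · exact h2 (n + 1) (by omega)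
      by_cases c4 : i.val = n + 2
      · exact h3 (n + 1) (by omega)
      exact h1 (i.val - 1) (by omega)
  · rintro ⟨h1, h2⟩
    cases hg : (fanGluing n).glue i f with
    | none => rfl
    | some a =>
      exfalso
      have := fanGluing_glue_eq_some_iff.1 (show _ = some (a.1, a.2) from hg)
      unfold FanGlueRel at this
      omega

theorem bijOn_insert_insert_singleton {N : ℕ} {e : Fin 4 → Fin N} (he : Function.Injective e)
    {f k₁ k₂ k₃ : Fin 4} (hk : ∀ k, k ≠ f ↔ k = k₁ ∨ k = k₂ ∨ k = k₃) {a b c : Fin N}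
    (h₁ : e k₁ = a) (h₂ : e k₂ = b) (h₃ : e k₃ = c) :
    Set.BijOn e {k | k ≠ f} {v | v ∈ ({a, b, c} : Finset (Fin N))} := by
  subst h₁ h₂ h₃
  refine ⟨fun k h => ?_, he.injOn, fun v h => ?_⟩
  · rcases (hk k).1 h with rfl | rfl | rfl <;> simp
  · simp only [Finset.mem_insert, Finset.mem_singleton, Set.mem_ofPred_eq] at h
    rcases h with rfl | rfl | rfl
    · exact ⟨k₁, (hk _).2 (Or.inl rfl), rfl⟩
    · exact ⟨k₂, (hk _).2 (Or.inr (Or.inl rfl)), rfl⟩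
    · exact ⟨k₃, (hk _).2 (Or.inr (Or.inr rfl)), rfl⟩

theorem fanLabel_bijOn_first {n : ℕ} (hn : 1 ≤ n) (b : Bool) {i : Fin (2 * n + 3)}
    (hi : i.val ≤ n) {u v w : Fin (2 * n + 4)} (hu : u.val = cond b 0 (n + 1))
    (hv : v.val = n + 2 + i.val) (hw : w.val = n + 3 + i.val) :
    Set.BijOn (fanLabel n i) {k | k ≠ cond b 1 0} {x | x ∈ ({u, v, w} : Finset _)} := by
  have h2 : fanLabel n i 2 = v := Fin.ext (by simp [fanLabel, fanLabelNat_first hi, hv])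
  have h3 : fanLabel n i 3 = w := Fin.ext (by simp [fanLabel, fanLabelNat_first hi, hw])
  cases b
  · refine bijOn_insert_insert_singleton (fanLabel_injective hn i) (k₁ := 1) (by decide)
      (Fin.ext ?_) h2 h3
    simp [fanLabel, fanLabelNat_first hi, hu]
  · refine bijOn_insert_insert_singleton (fanLabel_injective hn i) (k₁ := 0) (by decide)
      (Fin.ext ?_) h2 h3
    simp [fanLabel, fanLabelNat_first hi, hu]

theorem fanLabel_bijOn_second {n : ℕ} (hn : 1 ≤ n) (b : Bool) {i : Fin (2 * n + 3)} {j : ℕ}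
    (hi : i.val = n + 2 + j) {u v w : Fin (2 * n + 4)} (hu : u.val = j) (hv : v.val = j + 1)
    (hw : w.val = cond b (n + 2) (2 * n + 3)) :
    Set.BijOn (fanLabel n i) {k | k ≠ cond b 1 0} {x | x ∈ ({u, v, w} : Finset _)} := by
  have h2 : fanLabel n i 2 = u := Fin.ext (by simp [fanLabel, hi, fanLabelNat_second, hu])
  have h3 : fanLabel n i 3 = v := Fin.ext (by simp [fanLabel, hi, fanLabelNat_second, hv])
  cases b
  · refine bijOn_insert_insert_singleton (fanLabel_injective hn i) (k₃ := 1) (by decide)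
      h2 h3 (Fin.ext ?_)
    simp [fanLabel, hi, fanLabelNat_second, hw]
  · refine bijOn_insert_insert_singleton (fanLabel_injective hn i) (k₃ := 0) (by decide)
      h2 h3 (Fin.ext ?_)
    simp [fanLabel, hi, fanLabelNat_second, hw]

theorem isTriangle_iff_of_lt {n : ℕ} (b : Bool) {u v w : Fin (2 * n + 4)} (huv : u < v)
    (hvw : v < w) : (cond b (triPlus n) (triMinus n)).IsTriangle {u, v, w} ↔
      (u.val = cond b 0 (n + 1) ∧ n + 2 ≤ v.val ∧ w.val = v.val + 1) ∨
      (u.val ≤ n ∧ v.val = u.val + 1 ∧ w.val = cond b (n + 2) (2 * n + 3)) := by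
  cases b
  · refine (triMinus_isTriangle_iff huv hvw).trans ?_
    rw [Fin.lt_def] at huv
    simp only [cond_false]
    omega
  · exact triPlus_isTriangle_iff huv hvw

theorem fanGluing_exists_face {n : ℕ} (hn : 1 ≤ n) (b : Bool) (t : Finset (Fin (2 * n + 4)))
    (ht : (cond b (triPlus n) (triMinus n)).IsTriangle t) :
    ∃ i f, (fanGluing n).glue i f = none ∧
      Set.BijOn (fanLabel n i) {k | k ≠ f} {v | v ∈ t} := by
  obtain ⟨u, v, w, huv, hvw, rfl⟩ := Finset.exists_lt_lt_of_card_eq_three ht.1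
  have hw := w.isLt
  have hb : (cond b 1 0 : Fin 4).val ≤ 1 := by cases b <;> simp
  rcases (isTriangle_iff_of_lt b huv hvw).1 ht with ⟨h1, h2, h3⟩ | ⟨h1, h2, h3⟩
  · refine ⟨⟨v.val - (n + 2), by omega⟩, cond b 1 0, ?_, fanLabel_bijOn_first hn b ?_ h1 ?_ ?_⟩
    · exact fanGluing_glue_eq_none_iff.2 ⟨by simp only; omega, hb⟩
    all_goals simp only; omega
  · refine ⟨⟨n + 2 + u.val, by omega⟩, cond b 1 0, ?_, fanLabel_bijOn_second hn b rfl rfl h2 h3⟩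
    exact fanGluing_glue_eq_none_iff.2 ⟨by simp only; omega, hb⟩

theorem fanGluing_isTriangle {n : ℕ} (hn : 1 ≤ n) (i : Fin (2 * n + 3)) (f : Fin 4)
    (h : (fanGluing n).glue i f = none) :
    ∃ b t, (cond b (triPlus n) (triMinus n)).IsTriangle t ∧
      Set.BijOn (fanLabel n i) {k | k ≠ f} {v | v ∈ t} := by
  obtain ⟨h1, h2⟩ := fanGluing_glue_eq_none_iff.1 h
  obtain ⟨b, rfl⟩ : ∃ b : Bool, f = cond b 1 0 := by
    rcases Nat.le_one_iff_eq_zero_or_eq_one.1 h2 with h2 | h2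
    · exact ⟨false, Fin.ext h2⟩
    · exact ⟨true, Fin.ext h2⟩
  have hb0 : cond b 0 (n + 1) ≤ n + 1 := by cases b <;> simp
  have hb1 : n + 2 ≤ cond b (n + 2) (2 * n + 3) := by cases b <;> simp; omega
  have hb2 : cond b (n + 2) (2 * n + 3) < 2 * n + 4 := by cases b <;> simp; omega
  refine ⟨b, ?_⟩
  rcases fan_cases i.isLt with hi | hi | ⟨j, hj, hi⟩
  · refine ⟨_, (isTriangle_iff_of_lt b (u := ⟨cond b 0 (n + 1), by omega⟩)
      (v := ⟨n + 2 + i.val, by omega⟩) (w := ⟨n + 3 + i.val, by omega⟩) ?_ ?_).2 ?_,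
      fanLabel_bijOn_first hn b hi rfl rfl rfl⟩
    · simp only [Fin.lt_def]; omega
    · simp only [Fin.lt_def]; omega
    · exact Or.inl ⟨rfl, by simp only; omega, by simp only; omega⟩
  · exact absurd hi h1
  · refine ⟨_, (isTriangle_iff_of_lt b (u := ⟨j, by omega⟩) (v := ⟨j + 1, by omega⟩)
      (w := ⟨cond b (n + 2) (2 * n + 3), hb2⟩) ?_ ?_).2 ?_,
      fanLabel_bijOn_second hn b hi rfl rfl rfl⟩
    · simp only [Fin.lt_def]; omega
    · simp only [Fin.lt_def]; omega
    · exact Or.inr ⟨hj, rfl, rfl⟩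

/-- A triangle of `T⁺ₙ` and a triangle of `T⁻ₙ` have at most a side of the polygon in common. -/
theorem exists_side_of_isTriangle {n : ℕ} (t t' : Finset (Fin (2 * n + 4)))
    (ht : (triPlus n).IsTriangle t) (ht' : (triMinus n).IsTriangle t') :
    ∃ i j, IsSide s(i, j) ∧ ∀ k ∈ t, k ∈ t' → k = i ∨ k = j := by
  have key : ∀ u v : Fin (2 * n + 4), u < v → u ∈ t → u ∈ t' → v ∈ t → v ∈ t' → IsSide s(u, v) := by
    intro u v huv h1 h2 h3 h4
    have h5 := ht.2 u h1 v h3 huv.ne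
    have h6 := ht'.2 u h2 v h4 huv.ne
    rw [triPlus_isEdge_iff huv] at h5
    rw [triMinus_isEdge_iff huv] at h6
    rw [isSide_iff _ _ huv]
    omega
  by_cases hex : ∃ u v, u < v ∧ u ∈ t ∧ u ∈ t' ∧ v ∈ t ∧ v ∈ t'
  · obtain ⟨u, v, huv, h1, h2, h3, h4⟩ := hex
    refine ⟨u, v, key u v huv h1 h2 h3 h4, fun k hk hk' => ?_⟩
    by_contra hno
    push Not at hno
    have hsub : ({u, v, k} : Finset (Fin (2 * n + 4))) ⊆ t ∩ t' := by
      intro x hx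
      simp only [Finset.mem_insert, Finset.mem_singleton] at hx
      rcases hx with rfl | rfl | rfl <;> simp [*]
    have hc : ({u, v, k} : Finset (Fin (2 * n + 4))).card = 3 :=
      Finset.card_eq_three.2 ⟨u, v, k, huv.ne, hno.1.symm, hno.2.symm, rfl⟩
    have e1 := Finset.eq_of_subset_of_card_le (hsub.trans Finset.inter_subset_left)
      (by rw [hc, ht.1])
    have e2 := Finset.eq_of_subset_of_card_le (hsub.trans Finset.inter_subset_right)
      (by rw [hc, ht'.1])
    exact not_isTriangle_triPlus_triMinus n t ht (by rwa [← e1, e2])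
  · push Not at hex
    by_cases hne : ∃ u, u ∈ t ∧ u ∈ t'
    · obtain ⟨u, h1, h2⟩ := hne
      have hu := u.isLt
      have huniq : ∀ k ∈ t, k ∈ t' → k = u := by
        intro k hk hk'
        rcases lt_trichotomy k u with h | h | h
        · exact absurd h2 (hex k u h hk hk' h1)
        · exact h
        · exact absurd hk' (hex u k h h1 h2 hk)
      by_cases hlast : u.val + 1 < 2 * n + 4
      · exact ⟨u, ⟨u.val + 1, hlast⟩, (isSide_iff _ _ (by simp [Fin.lt_def])).2 (Or.inl rfl),
          fun k hk hk' => Or.inl (huniq k hk hk')⟩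
      · refine ⟨⟨u.val - 1, by omega⟩, u, (isSide_iff _ _ ?_).2 (Or.inl ?_),
          fun k hk hk' => Or.inr (huniq k hk hk')⟩
        · simp only [Fin.lt_def]; omega
        · simp only; omega
    · exact ⟨⟨0, by omega⟩, ⟨1, by omega⟩, (isSide_iff _ _ (by simp)).2 (Or.inl rfl),
        fun k hk hk' => absurd ⟨k, hk, hk'⟩ hne⟩

theorem fanGluing_extends {n : ℕ} (hn : 1 ≤ n) (hs : (fanGluing n).Separated (fanLabel n)) :
    (fanGluing n).Extends (triPlus n) (triMinus n) :=
  TetGluing.extends_of_labels (fanLabel_injective hn) (fanGluing_compatible n) hs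
    (fanGluing_exists_face hn) (fanGluing_isTriangle hn) exists_side_of_isTriangle

/-! ### Positions in space. -/

/-- The coordinates, in decreasing order, of the vertices of a path from `1` to `-1`. -/
noncomputable def pathCoord (n k : ℕ) : ℝ := if k = 0 then 1 else -((k : ℝ) - 1) / n

theorem pathCoord_zero (n : ℕ) : pathCoord n 0 = 1 := if_pos rfl

theorem pathCoord_succ (n k : ℕ) : pathCoord n (k + 1) = -(k : ℝ) / n := by
  rw [pathCoord, if_neg (by omega)]
  push_cast
  congr 1
  ring

theorem pathCoord_succ_nonpos (n k : ℕ) : pathCoord n (k + 1) ≤ 0 := by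
  rw [pathCoord_succ, neg_div]
  exact neg_nonpos.2 (by positivity)

theorem pathCoord_last {n : ℕ} (hn : 1 ≤ n) : pathCoord n (n + 1) = -1 := by
  have : (n : ℝ) ≠ 0 := by positivity
  rw [pathCoord_succ]
  field_simp

theorem pathCoord_strictAnti {n : ℕ} (hn : 1 ≤ n) : StrictAnti (pathCoord n) := by
  refine strictAnti_nat_of_succ_lt fun k => ?_
  rcases k with _ | k
  · rw [pathCoord_zero]
    exact (pathCoord_succ_nonpos n 0).trans_lt one_pos
  · rw [pathCoord_succ, pathCoord_succ]
    have : (0 : ℝ) < n := by positivity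
    push_cast
    gcongr
    linarith

theorem pathCoord_le_one {n : ℕ} (hn : 1 ≤ n) (k : ℕ) : pathCoord n k ≤ 1 :=
  ((pathCoord_strictAnti hn).antitone (Nat.zero_le k)).trans (pathCoord_zero n).le

theorem neg_one_le_pathCoord {n : ℕ} (hn : 1 ≤ n) {k : ℕ} (hk : k ≤ n + 1) :
    -1 ≤ pathCoord n k :=
  (pathCoord_last hn).ge.trans ((pathCoord_strictAnti hn).antitone hk)

theorem neg_one_lt_pathCoord {n : ℕ} (hn : 1 ≤ n) {k : ℕ} (hk : k ≤ n) :
    -1 < pathCoord n k :=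
  (pathCoord_last hn).ge.trans_lt (pathCoord_strictAnti hn (by omega))

/-- The second vertex of the path sits at $0$, so no edge passes through $0$ and the absolute value
is linear over each edge. Thus all path vertices can be put on the graph of a function of $|y|$ with
a single bend, and later ones may be collinear because the body need only be convex. -/
theorem abs_pathCoord_combination (n i : ℕ) {a b : ℝ} (ha : 0 ≤ a) (hb : 0 ≤ b) :
    |a * pathCoord n i + b * pathCoord n (i + 1)| =
      a * |pathCoord n i| + b * |pathCoord n (i + 1)| := by
  rcases i with _ | i
  · rw [pathCoord_zero, pathCoord_succ]
    simp [abs_of_nonneg ha]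
  · have h1 := pathCoord_succ_nonpos n i
    have h2 := pathCoord_succ_nonpos n (i + 1)
    rw [abs_of_nonpos h1, abs_of_nonpos h2, abs_of_nonpos (by nlinarith)]
    ring

theorem abs_pathCoord_combination_le {n i : ℕ} (hn : 1 ≤ n) (hi : i ≤ n) {a b : ℝ} (ha : 0 ≤ a)
    (hb : 0 ≤ b) : |a * pathCoord n i + b * pathCoord n (i + 1)| ≤ a + b := by
  have h1 : |pathCoord n i| ≤ 1 :=
    abs_le.2 ⟨neg_one_le_pathCoord hn (by omega), pathCoord_le_one hn _⟩
  have h2 : |pathCoord n (i + 1)| ≤ 1 :=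
    abs_le.2 ⟨neg_one_le_pathCoord hn (by omega), pathCoord_le_one hn _⟩
  rw [abs_pathCoord_combination n i ha hb]
  nlinarith

/-- A point of the cone over a path lies over one of its edges. -/
theorem exists_pathCoord_combination {n : ℕ} (hn : 1 ≤ n) {c y : ℝ} (hy : |y| ≤ c) :
    ∃ i ≤ n, ∃ a b : ℝ, 0 ≤ a ∧ 0 ≤ b ∧ a + b = c ∧
      a * pathCoord n i + b * pathCoord n (i + 1) = y := by
  have hc : 0 ≤ c := (abs_nonneg y).trans hy
  obtain ⟨hy1, hy2⟩ := abs_le.1 hy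
  have hex : ∃ k, c * pathCoord n (k + 1) ≤ y :=
    ⟨n, by rw [pathCoord_last hn]; linarith⟩
  classical
  have hle : Nat.find hex ≤ n := Nat.find_min' hex (by rw [pathCoord_last hn]; linarith)
  have hspec := Nat.find_spec hex
  have hge : y ≤ c * pathCoord n (Nat.find hex) := by
    rcases h : Nat.find hex with _ | k
    · rw [pathCoord_zero]
      linarith
    · exact (not_le.1 (Nat.find_min hex (show k < Nat.find hex by omega))).le
  set i := Nat.find hex
  have hlt : pathCoord n (i + 1) < pathCoord n i := pathCoord_strictAnti hn (by omega)
  have hd : 0 < pathCoord n i - pathCoord n (i + 1) := by linarith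
  -- The solution of $a+b=c$ and $a p_i+b p_{i+1}=y$, where $i$ is least with $c\,p_{i+1}\le y$. The
  -- denominator is $p_i-p_{i+1}$, so $c=0$ is allowed.
  refine ⟨i, hle, (y - c * pathCoord n (i + 1)) / (pathCoord n i - pathCoord n (i + 1)),
    (c * pathCoord n i - y) / (pathCoord n i - pathCoord n (i + 1)),
    div_nonneg (by linarith) hd.le, div_nonneg (by linarith) hd.le, ?_, ?_⟩
  · field_simp
    ring
  · field_simp
    ring

/-- The positions of the vertices in space: `B, v₁, ..., vₙ, A` in the plane `y = 0` and
`C, uₙ, ..., u₁, D` in the plane `x = 0`. -/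
noncomputable def fanPosition (n : ℕ) (c : Fin 3) (v : Fin (2 * n + 4)) : ℝ :=
  if v.val ≤ n + 1 then ![pathCoord n v.val, 0, 2 - 2 * |pathCoord n v.val|] c
  else ![0, pathCoord n (v.val - (n + 2)), 2 * |pathCoord n (v.val - (n + 2))| - 1] c

theorem fanPosition_of_le {n : ℕ} (c : Fin 3) {v : Fin (2 * n + 4)} {k : ℕ} (hv : v.val = k)
    (hk : k ≤ n + 1) : fanPosition n c v = ![pathCoord n k, 0, 2 - 2 * |pathCoord n k|] c := by
  subst hv
  rw [fanPosition, if_pos hk]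

theorem fanPosition_of_eq_add {n : ℕ} (c : Fin 3) {v : Fin (2 * n + 4)} {k : ℕ}
    (hv : v.val = n + 2 + k) :
    fanPosition n c v = ![0, pathCoord n k, 2 * |pathCoord n k| - 1] c := by
  rw [fanPosition, if_neg (by omega), hv, Nat.add_sub_cancel_left]

/-- The `j`-th tetrahedron of the fan around `AB`, for `s = true`, or around `CD`. -/
def fanIndex (n : ℕ) (s : Bool) (j : ℕ) (hj : j ≤ n) : Fin (2 * n + 3) :=
  ⟨cond s j (n + 2 + j), by cases s <;> simp only [cond_true, cond_false] <;> omega⟩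

/-- The tetrahedron `ABCD`. -/
def middleIndex (n : ℕ) : Fin (2 * n + 3) := ⟨n + 1, by omega⟩

/-- The coordinate along the axis of the fan `s`. -/
noncomputable def axisCoord (n : ℕ) (s : Bool) (a : Fin (2 * n + 3) × stdSimplex ℝ (Fin 4)) : ℝ :=
  TetGluing.labelSum (fanLabel n) (fanPosition n (cond s 0 1)) a

/-- The coordinate along the other axis. -/
noncomputable def sideCoord (n : ℕ) (s : Bool) (a : Fin (2 * n + 3) × stdSimplex ℝ (Fin 4)) : ℝ :=
  TetGluing.labelSum (fanLabel n) (fanPosition n (cond s 1 0)) a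

/-- The height above the axis of the fan `s`. -/
noncomputable def heightCoord (n : ℕ) (s : Bool) (a : Fin (2 * n + 3) × stdSimplex ℝ (Fin 4)) :
    ℝ :=
  cond s (TetGluing.labelSum (fanLabel n) (fanPosition n 2) a)
    (1 - TetGluing.labelSum (fanLabel n) (fanPosition n 2) a)

theorem stdSimplex_four (x : stdSimplex ℝ (Fin 4)) :
    0 ≤ x.1 0 ∧ 0 ≤ x.1 1 ∧ 0 ≤ x.1 2 ∧ 0 ≤ x.1 3 ∧ x.1 0 + x.1 1 + x.1 2 + x.1 3 = 1 := by
  refine ⟨x.2.1 0, x.2.1 1, x.2.1 2, x.2.1 3, ?_⟩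
  rw [← Fin.sum_univ_four]
  exact x.2.2

/-- The positions are symmetric under exchanging the two horizontal axes and replacing the height
$z$ by $1-z$, so one set of formulas serves both fans. The axis lies at height $0$ and the path on
the graph of $2|y|-1$. -/
theorem coords_fanIndex {n : ℕ} (hn : 1 ≤ n) (s : Bool) {j : ℕ} (hj : j ≤ n)
    (x : stdSimplex ℝ (Fin 4)) :
    axisCoord n s (fanIndex n s j hj, x) = x.1 0 - x.1 1 ∧
    sideCoord n s (fanIndex n s j hj, x) =
      x.1 2 * pathCoord n j + x.1 3 * pathCoord n (j + 1) ∧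
    heightCoord n s (fanIndex n s j hj, x) =
      2 * |x.1 2 * pathCoord n j + x.1 3 * pathCoord n (j + 1)| - (x.1 2 + x.1 3) := by
  obtain ⟨h0, h1, h2, h3, hsum⟩ := stdSimplex_four x
  rw [abs_pathCoord_combination n j h2 h3]
  cases s
  · have e : ∀ k, (fanLabel n (fanIndex n false j hj) k).val = ![n + 2, 2 * n + 3, j, j + 1] k :=
      fun k => congrFun (fanLabelNat_second n j) k
    have p0 := fun c => fanPosition_of_eq_add c (k := 0) (e 0)
    have p1 := fun c => fanPosition_of_eq_add c (k := n + 1) ((e 1).trans (by simp; omega))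
    have p2 := fun c => fanPosition_of_le c (e 2) (show j ≤ n + 1 by omega)
    have p3 := fun c => fanPosition_of_le c (e 3) (show j + 1 ≤ n + 1 by omega)
    simp only [axisCoord, sideCoord, heightCoord, TetGluing.labelSum, Fin.sum_univ_four, cond_false,
      p0, p1, p2, p3]
    simp [pathCoord_zero, pathCoord_last hn]
    refine ⟨by ring, ?_⟩
    linear_combination -hsum
  · have e : ∀ k, (fanLabel n (fanIndex n true j hj) k).val = ![0, n + 1, n + 2 + j, n + 3 + j] k :=
      fun k => congrFun (fanLabelNat_first hj) k
    have p0 := fun c => fanPosition_of_le c (e 0) (show 0 ≤ n + 1 by omega)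
    have p1 := fun c => fanPosition_of_le c (e 1) (show n + 1 ≤ n + 1 by omega)
    have p2 := fun c => fanPosition_of_eq_add c (k := j) (e 2)
    have p3 := fun c => fanPosition_of_eq_add c (k := j + 1) ((e 3).trans (by simp; omega))
    simp only [axisCoord, sideCoord, heightCoord, TetGluing.labelSum, Fin.sum_univ_four, cond_true,
      p0, p1, p2, p3]
    simp [pathCoord_zero, pathCoord_last hn]
    exact ⟨by ring, by ring⟩

/-- The map from the vertices of a tetrahedron at an end of the fan `s` to those of `ABCD`. -/
def fanPerm (s : Bool) : Equiv.Perm (Fin 4) := cond s 1 bridgePerm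

/-- Seen from either fan, $ABCD$ has one edge on the axis at height $0$ and the opposite edge across
it at height $1$. So in $ABCD$ the height is at least the absolute side coordinate, while in the fan
it is at most that. -/
theorem coords_middleIndex {n : ℕ} (hn : 1 ≤ n) (s : Bool) (x : stdSimplex ℝ (Fin 4)) :
    axisCoord n s (middleIndex n, x) = x.1 (fanPerm s 0) - x.1 (fanPerm s 1) ∧
    sideCoord n s (middleIndex n, x) = x.1 (fanPerm s 2) - x.1 (fanPerm s 3) ∧
    heightCoord n s (middleIndex n, x) = x.1 (fanPerm s 2) + x.1 (fanPerm s 3) := by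
  obtain ⟨h0, h1, h2, h3, hsum⟩ := stdSimplex_four x
  have b0 : bridgePerm 0 = 2 := by decide
  have b1 : bridgePerm 1 = 3 := by decide
  have b2 : bridgePerm 2 = 0 := by decide
  have b3 : bridgePerm 3 = 1 := by decide
  have e : ∀ k, (fanLabel n (middleIndex n) k).val = ![0, n + 1, n + 2, 2 * n + 3] k :=
    fun k => congrFun (fanLabelNat_middle n) k
  have p0 := fun c => fanPosition_of_le c (e 0) (show 0 ≤ n + 1 by omega)
  have p1 := fun c => fanPosition_of_le c (e 1) (show n + 1 ≤ n + 1 by omega)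
  have p2 := fun c => fanPosition_of_eq_add c (k := 0) (e 2)
  have p3 := fun c => fanPosition_of_eq_add c (k := n + 1) ((e 3).trans (by simp; omega))
  cases s
  · simp only [axisCoord, sideCoord, heightCoord, TetGluing.labelSum, Fin.sum_univ_four, cond_false,
      p0, p1, p2, p3, fanPerm, b0, b1, b2, b3]
    simp [pathCoord_zero, pathCoord_last hn]
    exact ⟨by ring, by ring, by linear_combination -hsum⟩
  · simp only [axisCoord, sideCoord, heightCoord, TetGluing.labelSum, Fin.sum_univ_four, cond_true,
      p0, p1, p2, p3, fanPerm, Equiv.Perm.coe_one, id]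
    simp [pathCoord_zero, pathCoord_last hn]
    exact ⟨by ring, by ring, by ring⟩

theorem stdSimplex_fanPerm (s : Bool) (x : stdSimplex ℝ (Fin 4)) :
    0 ≤ x.1 (fanPerm s 0) ∧ 0 ≤ x.1 (fanPerm s 1) ∧ 0 ≤ x.1 (fanPerm s 2) ∧
      0 ≤ x.1 (fanPerm s 3) ∧
      x.1 (fanPerm s 0) + x.1 (fanPerm s 1) + x.1 (fanPerm s 2) + x.1 (fanPerm s 3) = 1 := by
  refine ⟨x.2.1 _, x.2.1 _, x.2.1 _, x.2.1 _, ?_⟩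
  rw [← Fin.sum_univ_four fun k => x.1 (fanPerm s k), Equiv.sum_comp (fanPerm s) x.1]
  exact x.2.2

theorem labelMap_eq_iff {n : ℕ} (s : Bool) {a b : Fin (2 * n + 3) × stdSimplex ℝ (Fin 4)} :
    TetGluing.labelMap (fanLabel n) (fanPosition n) a =
      TetGluing.labelMap (fanLabel n) (fanPosition n) b ↔
    axisCoord n s a = axisCoord n s b ∧ sideCoord n s a = sideCoord n s b ∧
      heightCoord n s a = heightCoord n s b := by
  constructor
  · intro h
    have h' : ∀ c, TetGluing.labelSum (fanLabel n) (fanPosition n c) a =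
        TetGluing.labelSum (fanLabel n) (fanPosition n c) b := fun c =>
      congrArg (fun p : EuclideanSpace ℝ (Fin 3) => p c) h
    exact ⟨h' _, h' _, by rw [heightCoord, heightCoord, h' 2]⟩
  · rintro ⟨h1, h2, h3⟩
    have h' : ∀ c, TetGluing.labelSum (fanLabel n) (fanPosition n c) a =
        TetGluing.labelSum (fanLabel n) (fanPosition n c) b := by
      cases s
      · have h4 := sub_right_injective h3
        intro c
        fin_cases c
        exacts [h2, h1, h4]
      · intro c
        fin_cases c
        exacts [h1, h2, h3]
    simp only [TetGluing.labelMap, h']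

theorem fanPerm_inv (s : Bool) : (fanPerm s)⁻¹ = fanPerm s := by
  cases s
  · show bridgePerm⁻¹ = bridgePerm
    decide
  · rfl

theorem fanGluing_glue_up {n : ℕ} (s : Bool) {j : ℕ} (hj : j + 1 ≤ n) :
    (fanGluing n).glue (fanIndex n s j (by omega)) 2 =
      some (fanIndex n s (j + 1) hj, Equiv.swap 2 3) := by
  refine fanGluing_glue_eq_some_iff.2 (Or.inl ⟨rfl, Or.inl ⟨rfl, ?_⟩⟩)
  cases s <;> simp only [fanIndex, cond_true, cond_false, true_and] <;> omega

theorem fanGluing_glue_down {n : ℕ} (s : Bool) {j : ℕ} (hj : j + 1 ≤ n) :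
    (fanGluing n).glue (fanIndex n s (j + 1) hj) 3 =
      some (fanIndex n s j (by omega), Equiv.swap 2 3) := by
  refine fanGluing_glue_eq_some_iff.2 (Or.inl ⟨rfl, Or.inr ⟨rfl, ?_⟩⟩)
  cases s <;> simp only [fanIndex, cond_true, cond_false, true_and] <;> omega

theorem fanGluing_glue_first (n : ℕ) (s : Bool) :
    (fanGluing n).glue (fanIndex n s 0 (by omega)) 3 = some (middleIndex n, fanPerm s) := by
  refine fanGluing_glue_eq_some_iff.2 (Or.inr ?_)
  cases s
  · exact Or.inr ⟨rfl, Or.inr (Or.inr (Or.inr ⟨rfl, rfl, rfl⟩))⟩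
  · exact Or.inl ⟨rfl, Or.inr ⟨rfl, Or.inl ⟨rfl, rfl⟩⟩⟩

theorem fanGluing_glue_last (n : ℕ) (s : Bool) :
    (fanGluing n).glue (fanIndex n s n le_rfl) 2 = some (middleIndex n, fanPerm s) := by
  refine fanGluing_glue_eq_some_iff.2 (Or.inr ?_)
  cases s
  · exact Or.inr ⟨rfl, Or.inr (Or.inl ⟨rfl, by simp only [fanIndex, cond_false]; omega, rfl⟩)⟩
  · exact Or.inl ⟨rfl, Or.inl ⟨rfl, Or.inl ⟨rfl, rfl⟩⟩⟩

theorem fanGluing_glue_middle_first (n : ℕ) (s : Bool) :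
    (fanGluing n).glue (middleIndex n) (fanPerm s 3) =
      some (fanIndex n s 0 (by omega), fanPerm s) := by
  have h := (fanGluing n).glue_symm _ _ _ _ (fanGluing_glue_first n s)
  rwa [fanPerm_inv] at h

theorem fanGluing_glue_middle_last (n : ℕ) (s : Bool) :
    (fanGluing n).glue (middleIndex n) (fanPerm s 2) =
      some (fanIndex n s n le_rfl, fanPerm s) := by
  have h := (fanGluing n).glue_symm _ _ _ _ (fanGluing_glue_last n s)
  rwa [fanPerm_inv] at h

/-! ### Tetrahedra overlap only along glued faces. -/

/-- Points of the tetrahedra `i` and `j` with the same position in space are glued. -/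
def FanMerges (n : ℕ) (i j : Fin (2 * n + 3)) : Prop :=
  ∀ x y, TetGluing.labelMap (fanLabel n) (fanPosition n) (i, x) =
    TetGluing.labelMap (fanLabel n) (fanPosition n) (j, y) →
    Quot.mk (fanGluing n).Rel (i, x) = Quot.mk (fanGluing n).Rel (j, y)

theorem FanMerges.symm {n : ℕ} {i j : Fin (2 * n + 3)} (h : FanMerges n i j) : FanMerges n j i :=
  fun x y hxy => (h y x hxy.symm).symm

/-- If a common position forces the point of `i` onto a glued face, the point may be passed to the
neighbour `i'` without moving in space. Chains of such moves prove all cases below. -/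
theorem FanMerges.step {n : ℕ} {i i' j : Fin (2 * n + 3)} {f : Fin 4} {p : Equiv.Perm (Fin 4)}
    (hg : (fanGluing n).glue i f = some (i', p)) (h : FanMerges n i' j)
    (hf : ∀ x y, TetGluing.labelMap (fanLabel n) (fanPosition n) (i, x) =
      TetGluing.labelMap (fanLabel n) (fanPosition n) (j, y) → x.1 f = 0) : FanMerges n i j := by
  intro x y hxy
  obtain ⟨z, hz⟩ := TetGluing.exists_rel hg (hf x y hxy)
  refine (Quot.sound hz).trans (h z y (Eq.trans ?_ hxy))
  simp only [TetGluing.labelMap, (fanGluing_compatible n).labelSum_eq _ hz]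

/-- The tetrahedron is nondegenerate: equal side coordinate and height give equal $x_2+x_3$, then
$x_2$ and $x_3$ because $p_j\ne p_{j+1}$, then the rest. -/
theorem fanMerges_self_fanIndex {n : ℕ} (hn : 1 ≤ n) (s : Bool) {j : ℕ} (hj : j ≤ n) :
    FanMerges n (fanIndex n s j hj) (fanIndex n s j hj) := by
  intro x y hxy
  obtain ⟨h1, h2, h3⟩ := (labelMap_eq_iff s).1 hxy
  obtain ⟨x1, x2, x3⟩ := coords_fanIndex hn s hj x
  obtain ⟨y1, y2, y3⟩ := coords_fanIndex hn s hj y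
  obtain ⟨-, -, -, -, hx⟩ := stdSimplex_four x
  obtain ⟨-, -, -, -, hy⟩ := stdSimplex_four y
  rw [x1, y1] at h1
  rw [x2, y2] at h2
  rw [x3, y3, h2] at h3
  have hlt : pathCoord n (j + 1) < pathCoord n j := pathCoord_strictAnti hn (by omega)
  have e2 : x.1 2 = y.1 2 := by
    refine mul_right_cancel₀ (sub_ne_zero.2 hlt.ne') ?_
    linear_combination h2 + h3 * pathCoord n (j + 1)
  have : x = y := by
    refine Subtype.ext (funext fun k => ?_)
    fin_cases k
    · change x.1 0 = y.1 0
      linarith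
    · change x.1 1 = y.1 1
      linarith
    · exact e2
    · change x.1 3 = y.1 3
      linarith
  rw [this]

theorem fanMerges_self_middleIndex {n : ℕ} (hn : 1 ≤ n) :
    FanMerges n (middleIndex n) (middleIndex n) := by
  intro x y hxy
  obtain ⟨h1, h2, h3⟩ := (labelMap_eq_iff true).1 hxy
  obtain ⟨x1, x2, x3⟩ := coords_middleIndex hn true x
  obtain ⟨y1, y2, y3⟩ := coords_middleIndex hn true y
  obtain ⟨-, -, -, -, hx⟩ := stdSimplex_four x
  obtain ⟨-, -, -, -, hy⟩ := stdSimplex_four y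
  rw [x1, y1] at h1
  rw [x2, y2] at h2
  rw [x3, y3] at h3
  simp only [fanPerm, cond_true, Equiv.Perm.coe_one, id] at h1 h2 h3
  have : x = y := by
    refine Subtype.ext (funext fun k => ?_)
    fin_cases k
    · change x.1 0 = y.1 0
      linarith
    · change x.1 1 = y.1 1
      linarith
    · change x.1 2 = y.1 2
      linarith
    · change x.1 3 = y.1 3
      linarith
  rw [this]

/-- Equal positions have the same path weight $c=x_2+x_3$ and the same side coordinate. For $i<j$
the latter is at most $c\,p_{i+1}$, which forces $x_2=0$, and the point passes to tetrahedron $i+1$.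
-/
theorem fanMerges_fanIndex_of_le {n : ℕ} (hn : 1 ≤ n) (s : Bool) {i j : ℕ} (hij : i ≤ j)
    (hj : j ≤ n) : FanMerges n (fanIndex n s i (hij.trans hj)) (fanIndex n s j hj) := by
  induction hij using Nat.decreasingInduction with
  | self => exact fanMerges_self_fanIndex hn s hj
  | of_succ i hij ih =>
    refine ih.step (fanGluing_glue_up s (by omega)) fun x y hxy => ?_
    obtain ⟨-, h2, h3⟩ := (labelMap_eq_iff s).1 hxy
    obtain ⟨-, x2, x3⟩ := coords_fanIndex hn s (show i ≤ n by omega) x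
    obtain ⟨-, y2, y3⟩ := coords_fanIndex hn s hj y
    obtain ⟨-, -, a2, a3, -⟩ := stdSimplex_four x
    obtain ⟨-, -, b2, b3, -⟩ := stdSimplex_four y
    rw [x2, y2] at h2
    rw [x3, y3, h2] at h3
    have l1 : pathCoord n (i + 1) < pathCoord n i := pathCoord_strictAnti hn (by omega)
    have l2 : pathCoord n j ≤ pathCoord n (i + 1) := (pathCoord_strictAnti hn).antitone (by omega)
    have l3 : pathCoord n (j + 1) < pathCoord n j := pathCoord_strictAnti hn (by omega)
    have h4 : x.1 2 * (pathCoord n i - pathCoord n (i + 1)) ≤ 0 := by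
      have : y.1 2 * pathCoord n j + y.1 3 * pathCoord n (j + 1) ≤
          (y.1 2 + y.1 3) * pathCoord n (i + 1) := by nlinarith
      rw [show y.1 2 + y.1 3 = x.1 2 + x.1 3 by linarith, ← h2] at this
      linarith
    nlinarith

theorem fanMerges_fanIndex {n : ℕ} (hn : 1 ≤ n) (s : Bool) {i j : ℕ} (hi : i ≤ n) (hj : j ≤ n) :
    FanMerges n (fanIndex n s i hi) (fanIndex n s j hj) := by
  rcases le_total i j with h | h
  · exact fanMerges_fanIndex_of_le hn s h hj
  · exact (fanMerges_fanIndex_of_le hn s h hi).symm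

/-- A common point has height exactly $|Y|$, where $Y$ is its side coordinate, so it lies on one of
the two faces of $ABCD$ at the axis. For $j=n$ one has $Y\le0$, which selects the face shared with
the last tetrahedron. For $j<n$ either $Y\ge0$, which selects the face shared with the first, or the
point is on the axis, which lies in that face too. -/
theorem fanMerges_middleIndex {n : ℕ} (hn : 1 ≤ n) (s : Bool) {j : ℕ} (hj : j ≤ n) :
    FanMerges n (middleIndex n) (fanIndex n s j hj) := by
  have key : ∀ x y, TetGluing.labelMap (fanLabel n) (fanPosition n) (middleIndex n, x) =
      TetGluing.labelMap (fanLabel n) (fanPosition n) (fanIndex n s j hj, y) →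
      ∃ Y, x.1 (fanPerm s 2) - x.1 (fanPerm s 3) = Y ∧
        x.1 (fanPerm s 2) + x.1 (fanPerm s 3) = 2 * |Y| - (y.1 2 + y.1 3) ∧
        y.1 2 * pathCoord n j + y.1 3 * pathCoord n (j + 1) = Y ∧ |Y| ≤ y.1 2 + y.1 3 ∧
        0 ≤ x.1 (fanPerm s 2) ∧ 0 ≤ x.1 (fanPerm s 3) ∧ 0 ≤ y.1 2 ∧ 0 ≤ y.1 3 := by
    intro x y hxy
    obtain ⟨-, h2, h3⟩ := (labelMap_eq_iff s).1 hxy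
    obtain ⟨-, x2, x3⟩ := coords_middleIndex hn s x
    obtain ⟨-, y2, y3⟩ := coords_fanIndex hn s hj y
    obtain ⟨-, -, a2, a3, -⟩ := stdSimplex_fanPerm s x
    obtain ⟨-, -, b2, b3, -⟩ := stdSimplex_four y
    rw [x2, y2] at h2
    rw [x3, y3] at h3
    exact ⟨_, h2, h3, rfl, abs_pathCoord_combination_le hn hj b2 b3, a2, a3, b2, b3⟩
  rcases hj.eq_or_lt with rfl | hlt
  · refine (fanMerges_self_fanIndex hn s le_rfl).step (fanGluing_glue_middle_last j s)
      fun x y hxy => ?_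
    obtain ⟨Y, h1, h2, h3, h4, a2, a3, b2, b3⟩ := key x y hxy
    have hneg : Y ≤ 0 := by
      obtain ⟨k, rfl⟩ := Nat.exists_eq_succ_of_ne_zero (show j ≠ 0 by omega)
      have c1 := pathCoord_succ_nonpos (k + 1) k
      have c2 := pathCoord_succ_nonpos (k + 1) (k + 1)
      rw [← h3]
      nlinarith
    rw [abs_of_nonpos hneg] at h2 h4
    linarith
  · refine (fanMerges_fanIndex hn s (Nat.zero_le n) hj).step (fanGluing_glue_middle_first n s)
      fun x y hxy => ?_
    obtain ⟨Y, h1, h2, h3, h4, a2, a3, b2, b3⟩ := key x y hxy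
    have c1 := neg_one_lt_pathCoord hn hj
    have c2 := neg_one_lt_pathCoord hn (show j + 1 ≤ n by omega)
    rcases le_total 0 Y with hY | hY
    · rw [abs_of_nonneg hY] at h2 h4
      linarith
    · rw [abs_of_nonpos hY] at h2 h4
      have h5 : y.1 2 * (1 + pathCoord n j) + y.1 3 * (1 + pathCoord n (j + 1)) = 0 := by
        linarith
      have d1 : y.1 2 * (1 + pathCoord n j) = 0 := by nlinarith
      have d2 : y.1 3 * (1 + pathCoord n (j + 1)) = 0 := by nlinarith
      have d3 : y.1 2 = 0 := (mul_eq_zero.1 d1).resolve_right (by linarith)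
      have d4 : y.1 3 = 0 := (mul_eq_zero.1 d2).resolve_right (by linarith)
      linarith

/-- Points with the same position in both fans lie over the two ends of each path. -/
theorem abs_combination_eq_of_labelMap_eq {n : ℕ} (hn : 1 ≤ n) {i j : ℕ} (hi : i ≤ n) (hj : j ≤ n)
    {x y : stdSimplex ℝ (Fin 4)}
    (h : TetGluing.labelMap (fanLabel n) (fanPosition n) (fanIndex n true i hi, x) =
      TetGluing.labelMap (fanLabel n) (fanPosition n) (fanIndex n false j hj, y)) :
    x.1 2 * |pathCoord n i| + x.1 3 * |pathCoord n (i + 1)| = x.1 2 + x.1 3 := by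
  obtain ⟨h1, h2, h3⟩ := (labelMap_eq_iff true).1 h
  obtain ⟨x1, x2, x3⟩ := coords_fanIndex hn true hi x
  obtain ⟨y1, y2, y3⟩ := coords_fanIndex hn false hj y
  obtain ⟨a0, a1, a2, a3, hx⟩ := stdSimplex_four x
  obtain ⟨b0, b1, b2, b3, hy⟩ := stdSimplex_four y
  have s1 : axisCoord n true (fanIndex n false j hj, y) =
      sideCoord n false (fanIndex n false j hj, y) := rfl
  have s2 : sideCoord n true (fanIndex n false j hj, y) =
      axisCoord n false (fanIndex n false j hj, y) := rfl
  have s3 : heightCoord n true (fanIndex n false j hj, y) =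
      1 - heightCoord n false (fanIndex n false j hj, y) := by
    simp [heightCoord]
  rw [x1, s1, y2] at h1
  rw [x2, s2, y1] at h2
  rw [x3, s3, y3] at h3
  rw [← abs_pathCoord_combination n i a2 a3]
  have q1 := abs_pathCoord_combination_le hn hi a2 a3
  have q2 := abs_pathCoord_combination_le hn hj b2 b3
  have q3 : |y.1 2 * pathCoord n j + y.1 3 * pathCoord n (j + 1)| ≤ x.1 0 + x.1 1 := by
    rw [← h1]
    exact abs_le.2 ⟨by linarith, by linarith⟩
  have q4 : |x.1 2 * pathCoord n i + x.1 3 * pathCoord n (i + 1)| ≤ y.1 0 + y.1 1 := by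
    rw [h2]
    exact abs_le.2 ⟨by linarith, by linarith⟩
  -- With path weights $c,c'$ and horizontal coordinates $X,Y$, the heights add up to
  -- $2|X|+2|Y|-c-c'=1$. Together with $|Y|\le c$, $|X|\le c'$, $|X|\le1-c$ and $|Y|\le1-c'$ this
  -- forces $c+c'=1$ and equality, in particular $|Y|=c$.
  linarith

/-- A common point has weight only on path vertices with $|p|=1$, the ends of the path. So in
tetrahedron $n$ it lies on the face towards $ABCD$, and in the others it passes down the fan to the
first tetrahedron and from there to $ABCD$. -/
theorem fanMerges_fans {n : ℕ} (hn : 1 ≤ n) {i j : ℕ} (hi : i ≤ n) (hj : j ≤ n) :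
    FanMerges n (fanIndex n true i hi) (fanIndex n false j hj) := by
  rcases hi.eq_or_lt with rfl | hlt
  · refine (fanMerges_middleIndex hn false hj).step (fanGluing_glue_last i true)
      fun x y hxy => ?_
    have h := abs_combination_eq_of_labelMap_eq hn hi hj hxy
    obtain ⟨-, -, a2, a3, -⟩ := stdSimplex_four x
    rw [pathCoord_last hn] at h
    obtain ⟨k, rfl⟩ := Nat.exists_eq_succ_of_ne_zero (show i ≠ 0 by omega)
    have c1 := pathCoord_succ_nonpos (k + 1) k
    have c2 := neg_one_lt_pathCoord hn (le_refl (k + 1))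
    rw [abs_of_nonpos c1] at h
    norm_num at h
    nlinarith
  · have hf : ∀ i (hi : i ≤ n) (_ : i < n) (x y : stdSimplex ℝ (Fin 4)),
        TetGluing.labelMap (fanLabel n) (fanPosition n) (fanIndex n true i hi, x) =
        TetGluing.labelMap (fanLabel n) (fanPosition n) (fanIndex n false j hj, y) →
        x.1 3 = 0 := by
      intro i hi hlt x y hxy
      have h := abs_combination_eq_of_labelMap_eq hn hi hj hxy
      obtain ⟨-, -, a2, a3, -⟩ := stdSimplex_four x
      have c1 := pathCoord_succ_nonpos n i
      have c2 := neg_one_lt_pathCoord hn (show i + 1 ≤ n by omega)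
      have c3 : |pathCoord n i| ≤ 1 :=
        abs_le.2 ⟨neg_one_le_pathCoord hn (by omega), pathCoord_le_one hn _⟩
      rw [abs_of_nonpos c1] at h
      have d : x.1 3 * (1 + pathCoord n (i + 1)) ≤ 0 := by nlinarith
      nlinarith
    induction i with
    | zero =>
      exact (fanMerges_middleIndex hn false hj).step (fanGluing_glue_first n true) (hf 0 hi hlt)
    | succ i ih =>
      exact (ih (by omega) (by omega)).step (fanGluing_glue_down true hi) (hf _ hi hlt)

theorem fanIndex_cases {n : ℕ} (i : Fin (2 * n + 3)) :
    i = middleIndex n ∨ ∃ s j, ∃ hj : j ≤ n, i = fanIndex n s j hj := by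
  rcases fan_cases i.isLt with h | h | ⟨j, hj, h⟩
  · exact Or.inr ⟨true, i.val, h, rfl⟩
  · exact Or.inl (Fin.ext h)
  · exact Or.inr ⟨false, j, hj, Fin.ext h⟩

theorem fanMerges {n : ℕ} (hn : 1 ≤ n) (i j : Fin (2 * n + 3)) : FanMerges n i j := by
  rcases fanIndex_cases i with rfl | ⟨s, a, ha, rfl⟩ <;>
    rcases fanIndex_cases j with rfl | ⟨s', b, hb, rfl⟩
  · exact fanMerges_self_middleIndex hn
  · exact fanMerges_middleIndex hn s' hb
  · exact (fanMerges_middleIndex hn s ha).symm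
  · cases s <;> cases s'
    · exact fanMerges_fanIndex hn false ha hb
    · exact (fanMerges_fans hn hb ha).symm
    · exact fanMerges_fans hn ha hb
    · exact fanMerges_fanIndex hn true ha hb

/-! ### The tetrahedra fill a convex body. -/

/-- The union of the tetrahedra in space. -/
def fanBody : Set (EuclideanSpace ℝ (Fin 3)) :=
  {p | |p 0| + 2 * |p 1| - 1 ≤ p 2 ∧ |p 1| + 2 * |p 0| - 1 ≤ 1 - p 2}

theorem convex_fanBody : Convex ℝ fanBody := by
  intro p hp q hq a b ha hb hab
  obtain ⟨p1, p2⟩ := hp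
  obtain ⟨q1, q2⟩ := hq
  have habs : ∀ c, |(a • p + b • q) c| ≤ a * |p c| + b * |q c| := fun c => by
    refine (abs_add_le _ _).trans (le_of_eq ?_)
    simp [abs_mul, abs_of_nonneg ha, abs_of_nonneg hb]
  have e2 : (a • p + b • q) 2 = a * p 2 + b * q 2 := by simp
  have h0 := habs 0
  have h1 := habs 1
  have m1 := mul_le_mul_of_nonneg_left p1 ha
  have m2 := mul_le_mul_of_nonneg_left p2 ha
  have m3 := mul_le_mul_of_nonneg_left q1 hb
  have m4 := mul_le_mul_of_nonneg_left q2 hb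
  constructor
  · rw [e2]
    linarith
  · rw [e2]
    linarith

theorem interior_fanBody_nonempty : (interior fanBody).Nonempty := by
  have hc : ∀ c, Continuous fun p : EuclideanSpace ℝ (Fin 3) => p c := fun c => by fun_prop
  have hopen : IsOpen {p : EuclideanSpace ℝ (Fin 3) |
      |p 0| + 2 * |p 1| - 1 < p 2 ∧ |p 1| + 2 * |p 0| - 1 < 1 - p 2} := by
    refine IsOpen.and (isOpen_lt ?_ (hc 2)) (isOpen_lt ?_ (continuous_const.sub (hc 2)))
    · exact ((hc 0).abs.add (continuous_const.mul (hc 1).abs)).sub continuous_const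
    · exact ((hc 1).abs.add (continuous_const.mul (hc 0).abs)).sub continuous_const
  refine ⟨WithLp.toLp 2 ![0, 0, 1 / 2], interior_maximal ?_ hopen ?_⟩
  · exact fun p hp => ⟨hp.1.le, hp.2.le⟩
  · constructor <;> simp <;> norm_num

theorem mem_fanBody_iff {n : ℕ} (s : Bool) (a : Fin (2 * n + 3) × stdSimplex ℝ (Fin 4)) :
    TetGluing.labelMap (fanLabel n) (fanPosition n) a ∈ fanBody ↔
      |axisCoord n s a| + 2 * |sideCoord n s a| - 1 ≤ heightCoord n s a ∧
      |sideCoord n s a| + 2 * |axisCoord n s a| - 1 ≤ 1 - heightCoord n s a := by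
  cases s
  · simp only [heightCoord, cond_false, sub_sub_cancel]
    exact and_comm
  · exact Iff.rfl

theorem exists_stdSimplex_four {a b c d : ℝ} (ha : 0 ≤ a) (hb : 0 ≤ b) (hc : 0 ≤ c) (hd : 0 ≤ d)
    (h : a + b + c + d = 1) :
    ∃ x : stdSimplex ℝ (Fin 4), x.1 0 = a ∧ x.1 1 = b ∧ x.1 2 = c ∧ x.1 3 = d := by
  refine ⟨⟨![a, b, c, d], fun k => ?_, ?_⟩, rfl, rfl, rfl, rfl⟩
  · fin_cases k
    exacts [ha, hb, hc, hd]
  · rw [Fin.sum_univ_four]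
    exact h

/-- The formula for the height forces the path weight to be $2|q|-r$. The condition $r\le|q|$ then
says that $q$ is in reach of the path, and the first inequality that $p$ is in reach of the axis. -/
theorem exists_coords_fanIndex {n : ℕ} (hn : 1 ≤ n) (s : Bool) {p q r : ℝ}
    (h : |p| + 2 * |q| - 1 ≤ r) (hr : r ≤ |q|) :
    ∃ a, axisCoord n s a = p ∧ sideCoord n s a = q ∧ heightCoord n s a = r := by
  obtain ⟨j, hj, c, d, hc, hd, hcd, hq⟩ :=
    exists_pathCoord_combination hn (show |q| ≤ 2 * |q| - r by linarith)
  obtain ⟨p1, p2⟩ := abs_le.1 (show |p| ≤ 1 - (c + d) by linarith)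
  obtain ⟨x, h0, h1, h2, h3⟩ := exists_stdSimplex_four
    (show 0 ≤ (1 - (c + d) + p) / 2 by linarith) (show 0 ≤ (1 - (c + d) - p) / 2 by linarith)
    hc hd (by ring)
  obtain ⟨x1, x2, x3⟩ := coords_fanIndex hn s hj x
  refine ⟨(fanIndex n s j hj, x), ?_, ?_, ?_⟩
  · rw [x1, h0, h1]
    ring
  · rw [x2, h2, h3, hq]
  · rw [x3, h2, h3, hq, hcd]
    ring

/-- A point at height $z\le|y|$ belongs to the fan around $AB$, one with $1-z\le|x|$ to the fan
around $CD$, and if both fail it lies in $ABCD$. -/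
theorem range_labelMap_eq_fanBody {n : ℕ} (hn : 1 ≤ n) :
    Set.range (TetGluing.labelMap (fanLabel n) (fanPosition n)) = fanBody := by
  refine Set.Subset.antisymm ?_ fun p hp => ?_
  · rintro _ ⟨⟨i, x⟩, rfl⟩
    rcases fanIndex_cases i with rfl | ⟨s, j, hj, rfl⟩
    · rw [mem_fanBody_iff true]
      obtain ⟨x1, x2, x3⟩ := coords_middleIndex hn true x
      obtain ⟨a0, a1, a2, a3, hx⟩ := stdSimplex_fanPerm true x
      rw [x1, x2, x3]
      have q1 := abs_sub_le_of_nonneg_of_le a0 (le_add_of_nonneg_right a1) a1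
        (le_add_of_nonneg_left a0)
      have q2 := abs_sub_le_of_nonneg_of_le a2 (le_add_of_nonneg_right a3) a3
        (le_add_of_nonneg_left a2)
      constructor <;> linarith
    · rw [mem_fanBody_iff s]
      obtain ⟨x1, x2, x3⟩ := coords_fanIndex hn s hj x
      obtain ⟨a0, a1, a2, a3, hx⟩ := stdSimplex_four x
      rw [x1, x2, x3]
      have q1 := abs_sub_le_of_nonneg_of_le a0 (le_add_of_nonneg_right a1) a1
        (le_add_of_nonneg_left a0)
      have q2 := abs_pathCoord_combination_le hn hj a2 a3
      constructor <;> linarith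
  · obtain ⟨h1, h2⟩ := hp
    have conv : ∀ a, TetGluing.labelSum (fanLabel n) (fanPosition n 0) a = p 0 →
        TetGluing.labelSum (fanLabel n) (fanPosition n 1) a = p 1 →
        TetGluing.labelSum (fanLabel n) (fanPosition n 2) a = p 2 →
        p ∈ Set.range (TetGluing.labelMap (fanLabel n) (fanPosition n)) := by
      intro a e0 e1 e2
      refine ⟨a, ?_⟩
      ext c
      fin_cases c
      exacts [e0, e1, e2]
    by_cases c1 : p 2 ≤ |p 1|
    · obtain ⟨a, e0, e1, e2⟩ := exists_coords_fanIndex hn true h1 c1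
      exact conv a e0 e1 e2
    by_cases c2 : 1 - p 2 ≤ |p 0|
    · obtain ⟨a, e0, e1, e2⟩ := exists_coords_fanIndex hn false h2 c2
      exact conv a e1 e0 (sub_right_injective e2)
    · push Not at c1 c2
      obtain ⟨q1, q2⟩ := abs_lt.1 c1
      obtain ⟨q3, q4⟩ := abs_lt.1 c2
      -- The barycentric coordinates in $ABCD$: the pair $B,A$ has total weight $1-z$ and difference
      -- $x$, the pair $C,D$ total weight $z$ and difference $y$.
      obtain ⟨x, e0, e1, e2, e3⟩ := exists_stdSimplex_four
        (show 0 ≤ (1 - p 2 + p 0) / 2 by linarith) (show 0 ≤ (1 - p 2 - p 0) / 2 by linarith)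
        (show 0 ≤ (p 2 + p 1) / 2 by linarith) (show 0 ≤ (p 2 - p 1) / 2 by linarith) (by ring)
      obtain ⟨x1, x2, x3⟩ := coords_middleIndex hn true x
      simp only [fanPerm, cond_true, Equiv.Perm.coe_one, id, e0, e1, e2, e3] at x1 x2 x3
      exact conv _ (x1.trans (by ring)) (x2.trans (by ring)) (x3.trans (by ring))

theorem fanGluing_isBall {n : ℕ} (hn : 1 ≤ n) : (fanGluing n).IsBall := by
  refine TetGluing.isBall_of_labelMap (fanGluing_compatible n) (fanPosition n)
    (fun a b h => fanMerges hn a.1 b.1 a.2 b.2 h) ?_ ?_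
  · rw [range_labelMap_eq_fanBody hn]
    exact convex_fanBody
  · rw [range_labelMap_eq_fanBody hn]
    exact interior_fanBody_nonempty

/-! ### Conclusion. -/

theorem tet_triPlus_triMinus {n : ℕ} (hn : 2 ≤ n) : tet (triPlus n) (triMinus n) = 2 * n + 3 := by
  have h1 : 1 ≤ n := by omega
  have hmem : 2 * n + 3 ∈ {m | ∃ G : TetGluing m, G.IsBall ∧ G.Extends (triPlus n) (triMinus n)} :=
    ⟨fanGluing n, fanGluing_isBall h1, fanGluing_extends h1
      (TetGluing.separated_of_labelMap (fanPosition n)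
        fun a b h => fanMerges h1 a.1 b.1 a.2 b.2 h)⟩
  refine le_antisymm (Nat.sInf_le hmem) ?_
  obtain ⟨G, hG, hE⟩ := Nat.sInf_mem ⟨_, hmem⟩
  exact le_of_isBall_of_extends hn hG hE

theorem theorem1p1 :
    (∀ ε : ℝ, 0 < ε → ∃ (N : ℕ) (T T' : PolygonTriangulation N),
      0 < tet T T' ∧ |(flipDist T T' : ℝ) / (tet T T' : ℝ) - 3 / 2| < ε) ∧
    (∀ n : ℕ, 2 ≤ n →
      flipDist (triPlus n) (triMinus n) = 3 * n + 1 ∧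
      tet (triPlus n) (triMinus n) = 2 * n + 3) := by
  refine ⟨fun ε hε => ?_, fun n hn => ⟨flipDist_triPlus_triMinus n, tet_triPlus_triMinus hn⟩⟩
  -- With $n=k+2$ the ratio differs from $3/2$ by $7/(2(2n+3))$, which is less than
  -- $7/k<\varepsilon$; the shift by 2 ensures $n\ge2$.
  obtain ⟨k, hk⟩ := exists_nat_gt (7 / ε)
  refine ⟨2 * (k + 2) + 4, triPlus (k + 2), triMinus (k + 2), ?_, ?_⟩
  · rw [tet_triPlus_triMinus (by omega)]
    omega
  · rw [flipDist_triPlus_triMinus, tet_triPlus_triMinus (by omega)]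
    push_cast
    have hk0 : (0 : ℝ) ≤ k := k.cast_nonneg
    have hpos : (0 : ℝ) < 2 * (k + 2) + 3 := by linarith
    have h7 : 7 < k * ε := (div_lt_iff₀ hε).1 hk
    rw [show (3 * ((k : ℝ) + 2) + 1) / (2 * (k + 2) + 3) - 3 / 2 =
      -(7 / (2 * (2 * (k + 2) + 3))) by field_simp; ring, abs_neg, abs_of_pos (by positivity),
      div_lt_iff₀ (by linarith)]
    nlinarith
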